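/- Let $N$ be a smooth $m$-dimensional Riemannian manifold with distance $\mathrm{dist}$, complete in the sense that it admits a smooth isometric embedding with closed image into some $\mathbb R^K$; we regard $N\subseteq\mathbb R^K$ through such an embedding. Write $B_s=B_s(0)\subseteq\mathbb R^n$. A map $f:B_2\to N$ is a stationary harmonic map if $f\in W^{1,2}(B_2;\mathbb R^K)$ (and $f$ takes values in $N$), $$\int_{B_2}\sum_i\langle\partial_i f,\partial_i\varphi\rangle=0$$ for all bounded $\varphi\in W^{1,2}(B_2;\mathbb R^K)$ with compact support in $B_2$ and $\varphi(x)\in T_{f(x)}N$ for a.e. $x$, and $$\int_{B_2}\Big(|\nabla f|^2\,\mathrm{div}X-2\sum_{i,j}\langle\partial_i f,\partial_j f\rangle\,\partial_iX_j\Big)=0$$ for all $X\in C_c^\infty(B_2;\mathbb R^n)$. Put $\theta_s(0)=s^{2-n}\int_{B_s}|\nabla f|^2$. **Theorem 3.1.** For every $\Lambda\in\mathbb R$ and every $\eta>0$ there are $\epsilon=\epsilon(n,N,\Lambda,\eta)>0$ and $r=r(n,N,\Lambda,\eta)\in(0,1)$, independent of the map and of the embedding, with the following property. If $f:B_2\to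 N$ is a stationary harmonic map with $\int_{B_2}|\nabla f|^2<\Lambda$ and $$\theta_1(0)-\theta_r(0)\le\epsilon,$$ then $f$ is $(\eta,1,0)$-homogeneous at $0$, that is, there is a measurable map $h:\mathbb R^n\to N$ with $h(\lambda z)=h(z)$ for all $\lambda>0$ and $z\in\mathbb R^n$ such that $$\frac1{|B_1|}\int_{B_1}\mathrm{dist}(f(z),h(z))^2\,dz<\eta .$$ -/

import Mathlib

open MeasureTheory Set
open scoped Manifold ContDiff ENNReal Bundle

noncomputable section

namespace HarmonicMap

/-- Euclidean space of dimension `n`. -/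
abbrev Euc (n : ℕ) : Type := EuclideanSpace ℝ (Fin n)

/-- The standard basis vector `e_i`. -/
def basisVec {n : ℕ} (i : Fin n) : Euc n := EuclideanSpace.single i (1 : ℝ)

/-- `G` is the weak gradient of `u` on `Ω`: `G x i` is the weak partial derivative `∂_i u (x)`,
tested against smooth functions with compact support in `Ω`. -/
def IsWeakGradient {n K : ℕ} (Ω : Set (Euc n)) (u : Euc n → Euc K)
    (G : Euc n → Fin n → Euc K) : Prop :=
  ∀ φ : Euc n → ℝ, ContDiff ℝ ∞ φ → HasCompactSupport φ → tsupport φ ⊆ Ω →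
    ∀ i : Fin n,
      ∫ x in Ω, (fderiv ℝ φ x (basisVec i)) • u x = - ∫ x in Ω, φ x • G x i

/-- `u` belongs to the Sobolev space `W^{1,2}(Ω; ℝ^K)` and has weak gradient `G`. -/
structure IsSobolev {n K : ℕ} (Ω : Set (Euc n)) (u : Euc n → Euc K)
    (G : Euc n → Fin n → Euc K) : Prop where
  memLp : MemLp u 2 (volume.restrict Ω)
  memLp_grad : ∀ i : Fin n, MemLp (fun x => G x i) 2 (volume.restrict Ω)
  weakGradient : IsWeakGradient Ω u G

/-- The energy density `|∇u|² = ∑_i |∂_i u|²`. -/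
def energyDensity {n K : ℕ} (G : Euc n → Fin n → Euc K) (x : Euc n) : ℝ :=
  ∑ i : Fin n, ‖G x i‖ ^ 2

/-- The Dirichlet energy on `B_r(x)`. -/
def energy {n K : ℕ} (G : Euc n → Fin n → Euc K) (x : Euc n) (r : ℝ) : ℝ :=
  ∫ z in Metric.ball x r, energyDensity G z

/-- The normalized Dirichlet energy `θ_r(x) = r^{2-n} ∫_{B_r(x)} |∇u|²`. -/
def theta {n K : ℕ} (G : Euc n → Fin n → Euc K) (x : Euc n) (r : ℝ) : ℝ :=
  r ^ (2 - (n : ℤ)) * energy G x r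

section Target

variable {m K : ℕ} {N : Type*} [EMetricSpace N] [ChartedSpace (Euc m) N]

/-- The differential of `ι : N → ℝ^K` at `p`, applied to a tangent vector `v`. -/
def pushforward (ι : N → Euc K) (p : N) (v : TangentSpace (𝓡 m) p) : Euc K :=
  mfderiv (𝓡 m) 𝓘(ℝ, Euc K) ι p v

/-- `ι` is a smooth isometric embedding (in the sense of Riemannian metrics) of `N` in `ℝ^K`,
with closed image. -/
structure IsIsometricEmbedding (m : ℕ) {K : ℕ} {N : Type*} [EMetricSpace N]
    [ChartedSpace (Euc m) N] [Bundle.RiemannianBundle (fun p : N => TangentSpace (𝓡 m) p)]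
    (ι : N → Euc K) : Prop where
  contMDiff : ContMDiff (𝓡 m) 𝓘(ℝ, Euc K) ∞ ι
  isClosedEmbedding : Topology.IsClosedEmbedding ι
  norm_pushforward : ∀ (p : N) (v : TangentSpace (𝓡 m) p), ‖pushforward ι p v‖ = ‖v‖

/-- Weak harmonicity of `f : Ω → N ⊆ ℝ^K` with weak gradient `G`: `∫ ⟨∇f, ∇φ⟩ = 0` for all
bounded `W^{1,2}` fields `φ` along `f` that have compact support in `Ω` and are tangent to `N`,
`φ(x) ∈ T_{f(x)} N` for a.e. `x`. -/
def IsWeaklyHarmonic (m : ℕ) {n K : ℕ} {N : Type*} [EMetricSpace N] [ChartedSpace (Euc m) N]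
    (ι : N → Euc K) (Ω : Set (Euc n)) (f : Euc n → N) (G : Euc n → Fin n → Euc K) : Prop :=
  ∀ (φ : Euc n → Euc K) (Dφ : Euc n → Fin n → Euc K),
    IsSobolev Ω φ Dφ → (∃ C : ℝ, ∀ x, ‖φ x‖ ≤ C) →
    HasCompactSupport φ → tsupport φ ⊆ Ω →
    (∀ᵐ x ∂(volume.restrict Ω), ∃ v : TangentSpace (𝓡 m) (f x), pushforward ι (f x) v = φ x) →
    ∫ x in Ω, ∑ i : Fin n, inner ℝ (G x i) (Dφ x i) = 0

end Target

/-- Stationarity with respect to variations of the domain: the first variation of the Dirichlet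
energy along every smooth vector field `X` with compact support in `Ω` vanishes,
`∫ (|∇f|² div X - 2 ∑_{i,j} ⟨∂_i f, ∂_j f⟩ ∂_i X_j) = 0`. -/
def IsDomainStationary {n K : ℕ} (Ω : Set (Euc n)) (G : Euc n → Fin n → Euc K) : Prop :=
  ∀ X : Euc n → Euc n, ContDiff ℝ ∞ X → HasCompactSupport X → tsupport X ⊆ Ω →
    ∫ x in Ω, (energyDensity G x * (∑ i : Fin n, (fderiv ℝ X x (basisVec i)) i)
      - 2 * ∑ i : Fin n, ∑ j : Fin n,
          inner ℝ (G x i) (G x j) * (fderiv ℝ X x (basisVec i)) j) = 0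

/-- `f : Ω → N` is a stationary harmonic map, of class `W^{1,2}` with weak gradient `G`, the target
`N` being viewed inside `ℝ^K` through `ι`. Values of `f` and `G` outside `Ω` play no role. -/
structure IsStationaryHarmonic (m : ℕ) {n K : ℕ} {N : Type*} [EMetricSpace N]
    [ChartedSpace (Euc m) N] (ι : N → Euc K) (Ω : Set (Euc n)) (f : Euc n → N)
    (G : Euc n → Fin n → Euc K) : Prop where
  isSobolev : IsSobolev Ω (ι ∘ f) G
  isWeaklyHarmonic : IsWeaklyHarmonic m ι Ω f G
  isDomainStationary : IsDomainStationary Ω G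

/-- A measurable map `h : ℝ^n → N` is `k`-homogeneous (at the origin): it is invariant under
dilations, and under translations by the vectors of some `k`-plane. -/
def IsHomogeneous {n : ℕ} {N : Type*} [MeasurableSpace N] (k : ℕ) (h : Euc n → N) : Prop :=
  Measurable h ∧ ∃ V : Submodule ℝ (Euc n), Module.finrank ℝ V = k ∧
    (∀ (c : ℝ) (z : Euc n), 0 < c → h (c • z) = h z) ∧
    (∀ (z v : Euc n), v ∈ V → h (z + v) = h z)

/-- `f` is `(η, r, k)`-homogeneous at `x`: for some `k`-homogeneous map `h`, the average over the
unit ball of the squared distance in `N` between `z ↦ f (x + r z)` and `h` is less than `η`. -/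
def IsAlmostHomogeneous {n : ℕ} {N : Type*} [EMetricSpace N] [MeasurableSpace N]
    (η r : ℝ) (k : ℕ) (x : Euc n) (f : Euc n → N) : Prop :=
  ∃ h : Euc n → N, IsHomogeneous k h ∧
    laverage (volume.restrict (Metric.ball (0 : Euc n) 1))
      (fun z => edist (f (x + r • z)) (h z) ^ 2) < ENNReal.ofReal η

end HarmonicMap

end

/-!
The proof is direct: the homogeneous map is read off from the values of `f` on one sphere, and no
compactness is needed. This is why the constants do not depend on the embedding, and why the target
may be noncompact.

Write `R(x) = ∑ i, x i • ∂_i f (x)`, so that `|R(x)| / |x|` is the size of the radial derivative.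
Testing stationarity with the radial fields `P(|x|²) x`, where `P` approximates the primitive of
`-σ ^ (-n/2) / 2` on `(r², 1)`, gives the monotonicity formula
`θ_1 - θ_r = 2 ∫_{r < |x| < 1} |x| ^ (-n) |R|²` (`IsDomainStationary.theta_sub_theta`).

A Sobolev map is absolutely continuous along almost all rays. This is obtained by differentiating
`c ↦ ∫ φ(x) f(c x)` for test functions `φ`, and using Fubini to exchange the quantifiers over the
ray and over the two radii (`IsWeakEulerDeriv.ae_sub_eq_integral_ray`). An absolutely continuous
curve of `ℝ^K` in the closed set `N` has an intrinsic length, which bounds the distance of its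
endpoints (`edist_le_of_norm_sub_le_sub`): it suffices that to first order the distance of `N` is
at most the ambient one at each point (`eventually_edist_le`), with no uniformity in the point. So
for almost every `ρ` and almost every unit vector `w`, the distance from `f(t w)` to `f(ρ w)` is at
most the integral of the radial derivative between `t` and `ρ`.

Now fix such a `ρ` in `(r, 1)` and put `h(z) = f(ρ z / |z|)`. By the Cauchy-Schwarz inequality,
`∫ dist(f, h)²` over the unit ball is at most `r` times the energy, which accounts for `|z| ≤ r`,
plus `1/r` times the integral in the monotonicity formula, which accounts for `r < |z| < 1`
(`exists_isHomogeneous_lintegral_edist_sq_le`). Choose `r` small in terms of `Λ` and `η`, and then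
`ε` small in terms of `r`.
-/

namespace HarmonicMap

open Filter Topology Metric

/-! ### The intrinsic distance along curves in the ambient space -/

section Target

variable {m K : ℕ} {N : Type*} [EMetricSpace N] [ChartedSpace (Euc m) N] [IsManifold (𝓡 m) ∞ N]
  [Bundle.RiemannianBundle (fun p : N => TangentSpace (𝓡 m) p)] {ι : N → Euc K}

theorem contDiffAt_comp_extChartAt_symm (hι : IsIsometricEmbedding m ι) (p : N)
    {x : Euc m} (hx : x ∈ (extChartAt (𝓡 m) p).target) :
    ContDiffAt ℝ ∞ (ι ∘ (extChartAt (𝓡 m) p).symm) x := by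
  have h1 : ContMDiffAt 𝓘(ℝ, Euc m) (𝓡 m) ∞ (extChartAt (𝓡 m) p).symm x :=
    (contMDiffOn_extChartAt_symm p).contMDiffAt ((isOpen_extChartAt_target p).mem_nhds hx)
  exact (hι.contMDiff.contMDiffAt.comp x h1).contDiffAt

/-- The differential of a chart of `N`, measured in the Riemannian metric, has the norm of the
differential of the same chart read in the ambient Euclidean space. -/
theorem norm_mfderiv_extChartAt_symm (hι : IsIsometricEmbedding m ι) (p : N)
    {x : Euc m} (hx : x ∈ (extChartAt (𝓡 m) p).target) (v : Euc m) :
    ‖(mfderiv 𝓘(ℝ, Euc m) (𝓡 m) (extChartAt (𝓡 m) p).symm x v :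
        TangentSpace (𝓡 m) ((extChartAt (𝓡 m) p).symm x))‖
      = ‖fderiv ℝ (ι ∘ (extChartAt (𝓡 m) p).symm) x v‖ := by
  have h1 : MDifferentiableAt 𝓘(ℝ, Euc m) (𝓡 m) (extChartAt (𝓡 m) p).symm x :=
    ((contMDiffOn_extChartAt_symm (n := ∞) p).contMDiffAt
      ((isOpen_extChartAt_target p).mem_nhds hx)).mdifferentiableAt (by simp)
  have h2 : MDifferentiableAt (𝓡 m) 𝓘(ℝ, Euc K) ι ((extChartAt (𝓡 m) p).symm x) :=
    hι.contMDiff.contMDiffAt.mdifferentiableAt (by simp)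
  have h3 := mfderiv_comp x h2 h1
  rw [mfderiv_eq_fderiv] at h3
  rw [← hι.norm_pushforward, h3]
  rfl

/-- To first order at each point, the intrinsic distance is at most the ambient one. -/
theorem eventually_edist_le [IsRiemannianManifold (𝓡 m) N] (hι : IsIsometricEmbedding m ι) (p : N)
    {δ : ℝ} (hδ : 0 < δ) :
    ∀ᶠ q in 𝓝 p, edist p q ≤ ENNReal.ofReal ((1 + δ) * ‖ι q - ι p‖) := by
  set φ := extChartAt (𝓡 m) p with hφ
  set F : Euc m → Euc K := ι ∘ φ.symm with hF
  set x₀ := φ p with hx₀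
  have hx₀t : x₀ ∈ φ.target := mem_extChartAt_target p
  have hFd : ∀ x ∈ φ.target, ContDiffAt ℝ ∞ F x := fun x hx =>
    contDiffAt_comp_extChartAt_symm hι p hx
  -- the differential of the embedding in the chart is injective at `x₀`, hence bounded below
  obtain ⟨c, hc, hlow⟩ : ∃ c > (0 : ℝ), ∀ v, ‖v‖ ≤ c * ‖fderiv ℝ F x₀ v‖ := by
    obtain ⟨c, hc, h⟩ := LinearMap.exists_antilipschitzWith (fderiv ℝ F x₀ : Euc m →ₗ[ℝ] Euc K) (by
      rw [LinearMap.ker_eq_bot']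
      intro v hv
      have h1 := norm_mfderiv_extChartAt_symm hι p hx₀t v
      have h2 : ‖fderiv ℝ F x₀ v‖ = 0 := by simpa using hv
      rw [← hφ, ← hF, h2, norm_eq_zero] at h1
      have h3 := isInvertible_mfderivWithin_extChartAt_symm (I := 𝓡 m) (x := p) hx₀t
      rw [ModelWithCorners.range_eq_univ, mfderivWithin_univ] at h3
      exact h3.injective (h1.trans (map_zero _).symm))
    refine ⟨c, hc, fun v => ?_⟩
    simpa using h.le_mul_norm (map_zero _) v
  -- `δ'` makes both the variation of the differential along the segment and the linearization
  -- error small compared with the length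
  set δ' : ℝ := δ / (c * (2 + δ)) with hδ'
  have hδ'0 : 0 < δ' := by positivity
  obtain ⟨r, hr, hball⟩ : ∃ r > 0, ball x₀ r ⊆ φ.target ∩
      {x | ‖fderiv ℝ F x - fderiv ℝ F x₀‖ ≤ δ'} := by
    refine Metric.mem_nhds_iff.1 (inter_mem ((isOpen_extChartAt_target p).mem_nhds hx₀t) ?_)
    have h1 : ContinuousAt (fderiv ℝ F) x₀ :=
      ((hFd x₀ hx₀t).fderiv_right (m := 0) (by simp)).continuousAt
    filter_upwards [Metric.closedBall_mem_nhds _ hδ'0 |> h1] with x hx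
    simpa [dist_eq_norm] using hx
  filter_upwards [extChartAt_source_mem_nhds (I := 𝓡 m) p,
    (continuousAt_extChartAt (I := 𝓡 m) p).preimage_mem_nhds (ball_mem_nhds _ hr)] with q hq hqr
  set y₀ := φ q with hy₀
  set v := y₀ - x₀ with hv
  have hseg : ∀ t ∈ Icc (0 : ℝ) 1, x₀ + t • v ∈ ball x₀ r := by
    intro t ht
    exact (convex_ball x₀ r).add_smul_sub_mem (mem_ball_self hr) hqr ht
  have hcurve : ∀ t : ℝ, HasDerivAt (fun t : ℝ => x₀ + t • v) v t := fun t => by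
    simpa using ((hasDerivAt_id t).smul_const v).const_add x₀
  have hlen : edist p q ≤ Manifold.pathELength (𝓡 m) (fun t : ℝ => φ.symm (x₀ + t • v)) 0 1 := by
    rw [IsRiemannianManifold.out (I := 𝓡 m) p q]
    refine Manifold.riemannianEDist_le_pathELength (I := 𝓡 m) ?_ ?_ ?_ zero_le_one
    · have h1 : ContMDiffOn 𝓘(ℝ, Euc m) (𝓡 m) 1 φ.symm φ.target := contMDiffOn_extChartAt_symm p
      refine h1.comp (t := φ.target) (f := fun t : ℝ => x₀ + t • v) ?_
        (fun t ht => (hball (hseg t ht)).1)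
      rw [contMDiffOn_iff_contDiffOn]
      fun_prop
    · simp [hx₀, hφ]
    · simpa [hv, hy₀] using φ.left_inv hq
  have hDv : ∀ t ∈ Icc (0 : ℝ) 1, ‖fderiv ℝ F (x₀ + t • v) v‖ ≤ ‖fderiv ℝ F x₀ v‖ + δ' * ‖v‖ := by
    intro t ht
    have h1 := ((fderiv ℝ F (x₀ + t • v)) - fderiv ℝ F x₀).le_of_opNorm_le (hball (hseg t ht)).2 v
    rw [sub_apply] at h1
    linarith [norm_le_insert' (fderiv ℝ F (x₀ + t • v) v) (fderiv ℝ F x₀ v)]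
  have hlen2 : Manifold.pathELength (𝓡 m) (fun t : ℝ => φ.symm (x₀ + t • v)) 0 1
      ≤ ENNReal.ofReal (‖fderiv ℝ F x₀ v‖ + δ' * ‖v‖) := by
    rw [Manifold.pathELength_eq_lintegral_mfderiv_Icc]
    calc _ ≤ ∫⁻ t in Icc (0 : ℝ) 1, ENNReal.ofReal (‖fderiv ℝ F x₀ v‖ + δ' * ‖v‖) := by
          refine setLIntegral_mono' measurableSet_Icc fun t ht => ?_
          have hxt := (hball (hseg t ht)).1
          have h1 : MDifferentiableAt 𝓘(ℝ, Euc m) (𝓡 m) φ.symm (x₀ + t • v) :=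
            ((contMDiffOn_extChartAt_symm (n := ∞) p).contMDiffAt
              ((isOpen_extChartAt_target p).mem_nhds hxt)).mdifferentiableAt (by simp)
          have h2 : MDifferentiableAt 𝓘(ℝ, ℝ) 𝓘(ℝ, Euc m) (fun t : ℝ => x₀ + t • v) t :=
            (hcurve t).differentiableAt.mdifferentiableAt
          have h3 := mfderiv_comp t h1 h2
          have h4 : mfderiv 𝓘(ℝ, ℝ) (𝓡 m) (fun t : ℝ => φ.symm (x₀ + t • v)) t (1 : ℝ)
              = mfderiv 𝓘(ℝ, Euc m) (𝓡 m) φ.symm (x₀ + t • v) v := by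
            have h5 : mfderiv 𝓘(ℝ, ℝ) 𝓘(ℝ, Euc m) (fun t : ℝ => x₀ + t • v) t (1 : ℝ) = v := by
              rw [mfderiv_eq_fderiv]
              rw [(hcurve t).hasFDerivAt.fderiv]
              exact one_smul ℝ v
            calc _ = (mfderiv 𝓘(ℝ, Euc m) (𝓡 m) φ.symm (x₀ + t • v))
                    (mfderiv 𝓘(ℝ, ℝ) 𝓘(ℝ, Euc m) (fun t : ℝ => x₀ + t • v) t (1 : ℝ)) :=
                  congrArg (fun L => L (1 : ℝ)) h3
              _ = _ := by rw [h5]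
          have h6 : ‖(mfderiv 𝓘(ℝ, Euc m) (𝓡 m) φ.symm (x₀ + t • v) v :
              TangentSpace (𝓡 m) (φ.symm (x₀ + t • v)))‖ₑ
              ≤ ENNReal.ofReal (‖fderiv ℝ F x₀ v‖ + δ' * ‖v‖) := by
            rw [← ofReal_norm, norm_mfderiv_extChartAt_symm hι p hxt]
            exact ENNReal.ofReal_le_ofReal (hDv t ht)
          exact (congrArg (fun w : TangentSpace (𝓡 m) (φ.symm (x₀ + t • v)) => ‖w‖ₑ) h4).trans_le h6
      _ = _ := by simp
  have hlin : ‖F y₀ - F x₀ - fderiv ℝ F x₀ v‖ ≤ δ' * ‖v‖ :=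
    Convex.norm_image_sub_le_of_norm_fderiv_le' (𝕜 := ℝ)
      (fun x hx => (hFd x (hball hx).1).differentiableAt (by simp))
      (fun x hx => (hball hx).2) (convex_ball x₀ r) (mem_ball_self hr) hqr
  have hFy : F y₀ = ι q := by simp only [hF, Function.comp, hy₀]; rw [φ.left_inv hq]
  have hFx : F x₀ = ι p := by simp [hF, hx₀, hφ]
  rw [hFy, hFx] at hlin
  refine hlen.trans (hlen2.trans (ENNReal.ofReal_le_ofReal ?_))
  have h1 : ‖fderiv ℝ F x₀ v‖ ≤ ‖ι q - ι p‖ + δ' * ‖v‖ := by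
    have := norm_le_insert (ι q - ι p) (fderiv ℝ F x₀ v)
    linarith
  have h2 := hlow v
  have h3 : δ' * ‖v‖ ≤ δ / (2 + δ) * ‖fderiv ℝ F x₀ v‖ := by
    calc δ' * ‖v‖ ≤ δ' * (c * ‖fderiv ℝ F x₀ v‖) := by gcongr
      _ = _ := by rw [hδ']; field_simp
  have h4 : ‖fderiv ℝ F x₀ v‖ ≤ (2 + δ) / 2 * ‖ι q - ι p‖ := by
    have h5 : δ / (2 + δ) * ‖fderiv ℝ F x₀ v‖
      = ‖fderiv ℝ F x₀ v‖ - 2 / (2 + δ) * ‖fderiv ℝ F x₀ v‖ := by field_simp; ring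
    have h6 : 2 / (2 + δ) * ‖fderiv ℝ F x₀ v‖ ≤ ‖ι q - ι p‖ := by linarith
    calc _ = (2 + δ) / 2 * (2 / (2 + δ) * ‖fderiv ℝ F x₀ v‖) := by field_simp
      _ ≤ _ := by gcongr
  have h7 : δ / (2 + δ) * ‖fderiv ℝ F x₀ v‖ ≤ δ / (2 + δ) * ((2 + δ) / 2 * ‖ι q - ι p‖) := by
    gcongr
  have h8 : δ / (2 + δ) * ((2 + δ) / 2 * ‖ι q - ι p‖) = δ / 2 * ‖ι q - ι p‖ := by field_simp
  nlinarith

/-- A curve in `N` whose ambient increments are dominated by those of `V` has intrinsic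
increments dominated by those of `V`. -/
theorem edist_le_of_norm_sub_le_sub [IsRiemannianManifold (𝓡 m) N] (hι : IsIsometricEmbedding m ι)
    {a b : ℝ} (hab : a ≤ b) {c : ℝ → N} {V : ℝ → ℝ} (hV : ContinuousOn V (Icc a b))
    (h : ∀ s ∈ Icc a b, ∀ t ∈ Icc a b, s ≤ t → ‖ι (c t) - ι (c s)‖ ≤ V t - V s) :
    edist (c a) (c b) ≤ ENNReal.ofReal (V b - V a) := by
  have hmono : ∀ t ∈ Icc a b, V a ≤ V t := fun t ht => by
    have := (norm_nonneg _).trans (h a ⟨le_rfl, hab⟩ t ht ht.1)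
    linarith
  have hιc : ContinuousOn (fun t => ι (c t)) (Icc a b) := by
    intro t ht
    have h1 : Tendsto (fun s => |V s - V t|) (𝓝[Icc a b] t) (𝓝 0) := by
      have := ((hV t ht).tendsto.sub_const (V t)).abs
      simpa using this
    rw [ContinuousWithinAt, tendsto_iff_norm_sub_tendsto_zero]
    refine squeeze_zero' (Eventually.of_forall fun _ => norm_nonneg _) ?_ h1
    filter_upwards [self_mem_nhdsWithin] with s hs
    rcases le_total s t with hst | hst
    · rw [norm_sub_rev, abs_sub_comm]
      exact (h s hs t ht hst).trans (le_abs_self _)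
    · exact (h t ht s hs hst).trans (le_abs_self _)
  have hc : ContinuousOn c (Icc a b) :=
    hι.isClosedEmbedding.isInducing.continuousOn_iff.2 hιc
  -- up to a factor `1 + δ`, the set of times at which the bound holds is closed, and it is open to
  -- the right by the first order estimate at the current point
  have key : ∀ δ : ℝ, 0 < δ → edist (c a) (c b) ≤ ENNReal.ofReal ((1 + δ) * (V b - V a)) := by
    intro δ hδ
    set s : Set ℝ := {t | edist (c a) (c t) ≤ ENNReal.ofReal ((1 + δ) * (V t - V a))} with hs
    have hcl : IsClosed (s ∩ Icc a b) := by
      have h1 : ContinuousOn (fun t => edist (c a) (c t)) (Icc a b) :=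
        (continuous_const.edist continuous_id).comp_continuousOn hc
      have h2 : ContinuousOn (fun t => ENNReal.ofReal ((1 + δ) * (V t - V a))) (Icc a b) :=
        ENNReal.continuous_ofReal.comp_continuousOn (by fun_prop)
      have h3 := isClosed_Icc.isClosed_le h1 h2
      convert h3 using 1
      ext t; simp [hs, and_comm]
    have := hcl.Icc_subset_of_forall_mem_nhdsWithin (by simp [hs]) (by
      rintro t ⟨hts, hta⟩
      have htI : t ∈ Icc a b := Ico_subset_Icc_self hta
      have h1 : Tendsto c (𝓝[>] t) (𝓝 (c t)) := by
        refine (hc t htI).tendsto.mono_left ?_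
        rw [← nhdsWithin_Ioo_eq_nhdsGT hta.2]
        exact nhdsWithin_mono _ fun x hx => ⟨hta.1.trans hx.1.le, hx.2.le⟩
      filter_upwards [h1.eventually (eventually_edist_le hι (c t) hδ),
        Ioo_mem_nhdsGT hta.2] with u hu hut
      have huI : u ∈ Icc a b := ⟨hta.1.trans hut.1.le, hut.2.le⟩
      have h2 := h t htI u huI hut.1.le
      calc edist (c a) (c u) ≤ edist (c a) (c t) + edist (c t) (c u) := edist_triangle _ _ _
        _ ≤ ENNReal.ofReal ((1 + δ) * (V t - V a)) + ENNReal.ofReal ((1 + δ) * (V u - V t)) := by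
            refine add_le_add hts (hu.trans (ENNReal.ofReal_le_ofReal (by gcongr)))
        _ = ENNReal.ofReal ((1 + δ) * (V u - V a)) := by
            rw [← ENNReal.ofReal_add]
            · congr 1; ring
            · have := hmono t htI
              exact mul_nonneg (by linarith) (by linarith)
            · have := (norm_nonneg _).trans h2
              exact mul_nonneg (by linarith) (by linarith))
    exact this ⟨hab, le_rfl⟩
  have hlim : Tendsto (fun δ : ℝ => ENNReal.ofReal ((1 + δ) * (V b - V a))) (𝓝[>] 0)
      (𝓝 (ENNReal.ofReal (V b - V a))) := by
    refine (ENNReal.continuous_ofReal.tendsto _).comp ?_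
    have : Tendsto (fun δ : ℝ => (1 + δ) * (V b - V a)) (𝓝 0) (𝓝 ((1 + 0) * (V b - V a))) :=
      (by fun_prop : Continuous fun δ : ℝ => (1 + δ) * (V b - V a)).tendsto 0
    simpa using this.mono_left nhdsWithin_le_nhds
  exact ge_of_tendsto hlim (by filter_upwards [self_mem_nhdsWithin] with δ hδ using key δ hδ)

/-- A function that agrees almost everywhere in `(0, 1)` with an absolutely continuous curve of
`ℝ^K`, and takes its values in `N`, moves in `N` by at most the length of that curve. -/
theorem ae_edist_le_lintegral_of_ae_sub_eq [IsRiemannianManifold (𝓡 m) N]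
    (hι : IsIsometricEmbedding m ι) {w : ℝ → N} {g : ℝ → Euc K} {t₀ : ℝ} (ht₀ : t₀ ∈ Ioo (0 : ℝ) 1)
    (hg : ∀ s ∈ Ioo (0 : ℝ) 1, ∀ t ∈ Ioo (0 : ℝ) 1, IntervalIntegrable g volume s t)
    (hw : ∀ᵐ t, t ∈ Ioo (0 : ℝ) 1 → ι (w t) - ι (w t₀) = ∫ τ in t₀..t, g τ) :
    ∀ᵐ t, t ∈ Ioo (0 : ℝ) 1 → edist (w t) (w t₀) ≤ ∫⁻ τ in uIoc t₀ t, ‖g τ‖ₑ := by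
  have : Nonempty N := ⟨w t₀⟩
  set γ : ℝ → Euc K := fun t => ι (w t₀) + ∫ τ in t₀..t, g τ with hγ
  have hsub : ∀ s ∈ Ioo (0 : ℝ) 1, ∀ t ∈ Ioo (0 : ℝ) 1, γ t - γ s = ∫ τ in s..t, g τ := by
    intro s hs t ht
    simp only [hγ, add_sub_add_left_eq_sub]
    exact intervalIntegral.integral_interval_sub_left (hg _ ht₀ _ ht) (hg _ ht₀ _ hs)
  have hγc : ContinuousOn γ (Ioo 0 1) := by
    intro t ht
    obtain ⟨a, ha0, hat⟩ := exists_between (lt_min ht.1 ht₀.1)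
    obtain ⟨b, hbt, hb1⟩ := exists_between (max_lt ht.2 ht₀.2)
    have hab : uIcc a b = Icc a b :=
      uIcc_of_le ((hat.le.trans (min_le_left _ _)).trans ((le_max_left _ _).trans hbt.le))
    have h1 := intervalIntegral.continuousOn_primitive_interval' (a := t₀)
      (hg a ⟨ha0, (hat.trans_le (min_le_left _ _)).trans ht.2⟩ b
        ⟨ht.1.trans ((le_max_left _ _).trans_lt hbt), hb1⟩)
      (by rw [hab]; exact ⟨hat.le.trans (min_le_right _ _), (le_max_right _ _).trans hbt.le⟩)
    rw [hab] at h1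
    have h2 : Icc a b ∈ 𝓝 t := Icc_mem_nhds (hat.trans_le (min_le_left _ _))
      ((le_max_left _ _).trans_lt hbt)
    exact (continuousAt_const.add (h1.continuousAt h2)).continuousWithinAt
  -- the curve stays in the closed set `ι(N)`, as it does so at almost every time
  have hrange : ∀ t ∈ Ioo (0 : ℝ) 1, γ t ∈ range ι := by
    have hopen : IsOpen (Ioo (0 : ℝ) 1 ∩ γ ⁻¹' (range ι)ᶜ) :=
      hγc.isOpen_inter_preimage isOpen_Ioo hι.isClosedEmbedding.isClosed_range.isOpen_compl
    have hnull : volume (Ioo (0 : ℝ) 1 ∩ γ ⁻¹' (range ι)ᶜ) = 0 := by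
      refine measure_mono_null ?_ (ae_iff.1 hw)
      intro t ht h
      have h1 := h ht.1
      exact ht.2 ⟨w t, by simp only [hγ]; rw [← h1]; abel⟩
    intro t ht
    by_contra hcon
    have := hopen.measure_eq_zero_iff volume |>.1 hnull
    exact (this ▸ (⟨ht, hcon⟩ : t ∈ Ioo (0 : ℝ) 1 ∩ γ ⁻¹' (range ι)ᶜ) : t ∈ (∅ : Set ℝ))
  set c : ℝ → N := fun t => Function.invFun ι (γ t) with hc
  have hιc : ∀ t ∈ Ioo (0 : ℝ) 1, ι (c t) = γ t := fun t ht => Function.invFun_eq (hrange t ht)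
  have hlen : ∀ a ∈ Ioo (0 : ℝ) 1, ∀ b ∈ Ioo (0 : ℝ) 1, a ≤ b →
      edist (c a) (c b) ≤ ∫⁻ τ in Ioc a b, ‖g τ‖ₑ := by
    intro a ha b hb hab
    have hsubset : Icc a b ⊆ Ioo 0 1 := fun x hx => ⟨ha.1.trans_le hx.1, hx.2.trans_lt hb.2⟩
    have hI : ∀ s ∈ Icc a b, ∀ t ∈ Icc a b, IntervalIntegrable (fun τ => ‖g τ‖) volume s t :=
      fun s hs t ht => (hg s (hsubset hs) t (hsubset ht)).norm
    have h1 := edist_le_of_norm_sub_le_sub hι hab (c := c) (V := fun t => ∫ τ in a..t, ‖g τ‖) (by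
        have := intervalIntegral.continuousOn_primitive_interval' (a := a)
          (hI a ⟨le_rfl, hab⟩ b ⟨hab, le_rfl⟩) left_mem_uIcc
        rwa [uIcc_of_le hab] at this) (by
        intro s hs t ht hst
        rw [hιc s (hsubset hs), hιc t (hsubset ht), hsub _ (hsubset hs) _ (hsubset ht),
          intervalIntegral.integral_interval_sub_left (hI a ⟨le_rfl, hab⟩ t ht)
            (hI a ⟨le_rfl, hab⟩ s hs)]
        exact intervalIntegral.norm_integral_le_integral_norm hst)
    refine h1.trans (le_of_eq ?_)
    rw [intervalIntegral.integral_same, sub_zero, intervalIntegral.integral_of_le hab]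
    exact ofReal_integral_norm_eq_lintegral_enorm (hg a ha b hb).1
  have hct₀ : c t₀ = w t₀ := hι.isClosedEmbedding.injective (by rw [hιc t₀ ht₀]; simp [hγ])
  filter_upwards [hw] with t h ht
  have hct : c t = w t := hι.isClosedEmbedding.injective (by
    rw [hιc t ht]; simp only [hγ]; rw [← h ht]; abel)
  rw [← hct, ← hct₀]
  rcases le_total t₀ t with htt | htt
  · rw [uIoc_of_le htt, edist_comm]; exact hlen t₀ ht₀ t ht htt
  · rw [uIoc_of_ge htt]; exact hlen t ht t₀ ht₀ htt

end Target

/-! ### The monotonicity formula -/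

section Monotonicity

variable {n K : ℕ} {G : Euc n → Fin n → Euc K}

/-- The derivative `∑ i, x i • ∂_i u (x)` of a map with gradient `G` along the position vector
field, that is, `|x|` times the derivative in the radial direction. -/
noncomputable def eulerDeriv (G : Euc n → Fin n → Euc K) (x : Euc n) : Euc K :=
  ∑ i : Fin n, x i • G x i

theorem energyDensity_nonneg (G : Euc n → Fin n → Euc K) (x : Euc n) : 0 ≤ energyDensity G x :=
  Finset.sum_nonneg fun _ _ => sq_nonneg _

theorem norm_eulerDeriv_sq_le (G : Euc n → Fin n → Euc K) (x : Euc n) :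
    ‖eulerDeriv G x‖ ^ 2 ≤ ‖x‖ ^ 2 * energyDensity G x := by
  have h1 : ‖eulerDeriv G x‖ ≤ ∑ i, |x i| * ‖G x i‖ := by
    refine (norm_sum_le _ _).trans (le_of_eq ?_)
    simp [norm_smul]
  calc ‖eulerDeriv G x‖ ^ 2 ≤ (∑ i, |x i| * ‖G x i‖) ^ 2 := by gcongr
    _ ≤ (∑ i, |x i| ^ 2) * ∑ i, ‖G x i‖ ^ 2 := Finset.sum_mul_sq_le_sq_mul_sq _ _ _
    _ = ‖x‖ ^ 2 * energyDensity G x := by simp [EuclideanSpace.norm_sq_eq, energyDensity]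

theorem norm_eulerDeriv_sq (G : Euc n → Fin n → Euc K) (x : Euc n) :
    ‖eulerDeriv G x‖ ^ 2 = ∑ i, ∑ j, inner ℝ (G x i) (G x j) * (x i * x j) := by
  rw [← real_inner_self_eq_norm_sq, eulerDeriv, sum_inner]
  refine Finset.sum_congr rfl fun i _ => ?_
  rw [inner_sum]
  refine Finset.sum_congr rfl fun j _ => ?_
  rw [inner_smul_left, inner_smul_right]
  simp; ring

theorem integrableOn_energyDensity {s : Set (Euc n)}
    (hG : ∀ i, MemLp (fun x => G x i) 2 (volume.restrict s)) :
    IntegrableOn (energyDensity G) s :=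
  integrable_finsetSum _ fun i _ => (hG i).integrable_norm_pow (by simp)

theorem aestronglyMeasurable_eulerDeriv {s : Set (Euc n)}
    (hG : ∀ i, MemLp (fun x => G x i) 2 (volume.restrict s)) :
    AEStronglyMeasurable (eulerDeriv G) (volume.restrict s) := by
  refine Finset.aestronglyMeasurable_fun_sum _ fun i _ => ?_
  exact (by fun_prop : Continuous fun x : Euc n => x i).aestronglyMeasurable.smul (hG i).1

/-- The first variation formula for a radial vector field `x ↦ P (|x|²) x`. -/
theorem IsDomainStationary.integral_radial_eq_zero (hst : IsDomainStationary (ball (0 : Euc n) 2) G)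
    {P P' : ℝ → ℝ} (hP : ContDiff ℝ ∞ P) (hP' : ∀ σ, HasDerivAt P (P' σ) σ)
    (hsupp : ∀ σ, 1 ≤ σ → P σ = 0) :
    ∫ x in ball (0 : Euc n) 2, ((((n : ℝ) - 2) * P (‖x‖ ^ 2) + 2 * P' (‖x‖ ^ 2) * ‖x‖ ^ 2)
      * energyDensity G x - 4 * P' (‖x‖ ^ 2) * ‖eulerDeriv G x‖ ^ 2) = 0 := by
  set X : Euc n → Euc n := fun x => P (‖x‖ ^ 2) • x with hX
  have hXs : Function.support X ⊆ closedBall 0 1 := by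
    intro x hx
    by_contra hcon
    rw [mem_closedBall_zero_iff, not_le] at hcon
    exact hx (by simp [hX, hsupp _ (one_le_pow₀ hcon.le)])
  have hXt : tsupport X ⊆ closedBall 0 1 := closure_minimal hXs isClosed_closedBall
  have hXd : ∀ x v, fderiv ℝ X x v
      = P (‖x‖ ^ 2) • v + (2 * P' (‖x‖ ^ 2) * inner ℝ x v) • x := by
    intro x v
    have h1 : HasFDerivAt (fun x : Euc n => P (‖x‖ ^ 2)) _ x :=
      (hP' (‖x‖ ^ 2)).comp_hasFDerivAt x (hasStrictFDerivAt_norm_sq x).hasFDerivAt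
    have h2 : HasFDerivAt X _ x := h1.smul (hasFDerivAt_id x)
    rw [h2.fderiv]
    simp
    ring_nf
  have h := hst X (by rw [hX]; exact (hP.comp (contDiff_norm_sq ℝ)).smul contDiff_id)
    (HasCompactSupport.of_support_subset_isCompact (isCompact_closedBall 0 1) hXs)
    (hXt.trans (closedBall_subset_ball (by norm_num)))
  rw [← h]
  refine integral_congr_ae (Eventually.of_forall fun x => ?_)
  have hc : ∀ i j, (fderiv ℝ X x (basisVec i)) j
      = P (‖x‖ ^ 2) * (if j = i then 1 else 0) + 2 * P' (‖x‖ ^ 2) * (x i * x j) := by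
    intro i j
    rw [hXd]
    simp [basisVec, EuclideanSpace.inner_single_right]
    ring
  have hdiv : ∑ i, (fderiv ℝ X x (basisVec i)) i
      = n * P (‖x‖ ^ 2) + 2 * P' (‖x‖ ^ 2) * ‖x‖ ^ 2 := by
    simp only [hc, if_true, Finset.sum_add_distrib, ← Finset.mul_sum]
    rw [EuclideanSpace.norm_sq_eq x]
    simp [mul_comm, pow_two]
  have hquad : ∑ i, ∑ j, inner ℝ (G x i) (G x j) * (fderiv ℝ X x (basisVec i)) j
      = P (‖x‖ ^ 2) * energyDensity G x + 2 * P' (‖x‖ ^ 2) * ‖eulerDeriv G x‖ ^ 2 := by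
    rw [norm_eulerDeriv_sq, energyDensity, Finset.mul_sum, Finset.mul_sum, ← Finset.sum_add_distrib]
    refine Finset.sum_congr rfl fun i _ => ?_
    simp only [hc, mul_add, Finset.sum_add_distrib, Finset.mul_sum]
    congr 1
    · simp [mul_comm]
    · refine Finset.sum_congr rfl fun j _ => by ring
  simp only [hdiv, hquad]
  ring

/-- The weight `σ ^ (-n/2)`, cut off to `(a, 1)`. In terms of `σ = |x|²` it is the density
`|x| ^ (-n)` of the monotonicity formula. -/
noncomputable def annulusWeight (n : ℕ) (a σ : ℝ) : ℝ := (Ioo a 1).indicator (fun τ => τ ^ (-(n : ℝ) / 2)) σ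

/-- Smooth functions with values in `[0, 1]`, supported in `[a, 1]`, that converge pointwise to the
indicator of `(a, 1)` as `k → ∞`. -/
noncomputable def annulusCutoff (a : ℝ) (k : ℕ) (τ : ℝ) : ℝ :=
  Real.smoothTransition (k * (τ - a)) * Real.smoothTransition (k * (1 - τ))

theorem annulusCutoff_nonneg (a : ℝ) (k : ℕ) (τ : ℝ) : 0 ≤ annulusCutoff a k τ :=
  mul_nonneg (Real.smoothTransition.nonneg _) (Real.smoothTransition.nonneg _)

theorem annulusCutoff_le_one (a : ℝ) (k : ℕ) (τ : ℝ) : annulusCutoff a k τ ≤ 1 :=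
  mul_le_one₀ (Real.smoothTransition.le_one _) (Real.smoothTransition.nonneg _)
    (Real.smoothTransition.le_one _)

theorem annulusCutoff_of_notMem {a : ℝ} (k : ℕ) {τ : ℝ} (h : τ ∉ Ioo a 1) :
    annulusCutoff a k τ = 0 := by
  rw [mem_Ioo, not_and_or, not_lt, not_lt] at h
  rcases h with h | h
  · rw [annulusCutoff, Real.smoothTransition.zero_of_nonpos
      (mul_nonpos_of_nonneg_of_nonpos (Nat.cast_nonneg _) (by linarith)), zero_mul]
  · rw [annulusCutoff, Real.smoothTransition.zero_of_nonpos (x := k * (1 - τ))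
      (mul_nonpos_of_nonneg_of_nonpos (Nat.cast_nonneg _) (by linarith)), mul_zero]

theorem contDiff_annulusCutoff (a : ℝ) (k : ℕ) : ContDiff ℝ ∞ (annulusCutoff a k) := by
  unfold annulusCutoff
  exact (Real.smoothTransition.contDiff.comp (by fun_prop)).mul
    (Real.smoothTransition.contDiff.comp (by fun_prop))

theorem tendsto_annulusCutoff {a τ : ℝ} (h : τ ∈ Ioo a 1) :
    Tendsto (fun k => annulusCutoff a k τ) atTop (𝓝 1) := by
  have key : ∀ c : ℝ, 0 < c → ∀ᶠ k : ℕ in atTop, Real.smoothTransition (k * c) = 1 := by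
    intro c hc
    have : Tendsto (fun k : ℕ => (k : ℝ) * c) atTop atTop :=
      tendsto_natCast_atTop_atTop.atTop_mul_const hc
    filter_upwards [this.eventually_ge_atTop 1] with k hk
    exact Real.smoothTransition.one_of_one_le hk
  refine tendsto_const_nhds.congr' ?_
  filter_upwards [key (τ - a) (by linarith [h.1]), key (1 - τ) (by linarith [h.2])] with k h1 h2
  rw [annulusCutoff, h1, h2, one_mul]

/-- For `P` the primitive of `-κ/2` vanishing at `1`, where `κ` is the weight above, the coefficient
`(n - 2) P + 2 σ P'` of the energy density in the radial first variation formula is piecewise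
constant. With `a = r²`, its values produce exactly the two normalized energies of the monotonicity
formula. -/
theorem sub_two_mul_integral_annulusWeight {a σ : ℝ} (ha : 0 < a) (ha1 : a < 1) :
    ((n : ℝ) - 2) * (-(1 / 2) * ∫ τ in (1 : ℝ)..σ, annulusWeight n a τ) - annulusWeight n a σ * σ
      = (Iic a).indicator (fun _ => a ^ (1 - (n : ℝ) / 2)) σ - (Iio 1).indicator (fun _ => 1) σ := by
  rcases le_or_gt 1 σ with h1 | h1
  · have h2 : ∀ τ, 1 ≤ τ → annulusWeight n a τ = 0 := fun τ hτ =>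
      indicator_of_notMem (fun h => absurd h.2 (not_lt.2 hτ)) _
    have h3 : ∫ τ in (1 : ℝ)..σ, annulusWeight n a τ = 0 := by
      rw [intervalIntegral.integral_congr (g := fun _ => 0)]
      · simp
      · intro τ hτ
        rw [uIcc_of_le h1] at hτ
        exact h2 τ hτ.1
    rw [h3, h2 σ h1, indicator_of_notMem (by simp; linarith), indicator_of_notMem (by simpa)]
    simp
  · set b := max σ a with hb
    have hb0 : 0 < b := ha.trans_le (le_max_right _ _)
    have hb1 : b < 1 := max_lt h1 ha1
    have h2 : ((n : ℝ) - 2) * (-(1 / 2) * ∫ τ in (1 : ℝ)..σ, annulusWeight n a τ)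
        = b ^ (1 - (n : ℝ) / 2) - 1 := by
      have h3 : ∫ τ in (1 : ℝ)..σ, annulusWeight n a τ
          = - ∫ τ in b..1, τ ^ (-(n : ℝ) / 2) := by
        rw [intervalIntegral.integral_symm, intervalIntegral.integral_of_le h1.le,
          intervalIntegral.integral_of_le hb1.le]
        unfold annulusWeight
        rw [setIntegral_indicator measurableSet_Ioo, integral_Ioc_eq_integral_Ioo]
        congr 3
        ext τ
        simp only [mem_inter_iff, mem_Ioc, mem_Ioo, hb, max_lt_iff]
        constructor
        · rintro ⟨⟨h, -⟩, h', h''⟩; exact ⟨⟨h, h'⟩, h''⟩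
        · rintro ⟨⟨h, h'⟩, h''⟩; exact ⟨⟨h, h''.le⟩, h', h''⟩
      have h4 : ∫ τ in b..1, (1 - (n : ℝ) / 2) * τ ^ (-(n : ℝ) / 2)
          = 1 - b ^ (1 - (n : ℝ) / 2) := by
        rw [intervalIntegral.integral_eq_sub_of_hasDerivAt (f := fun τ => τ ^ (1 - (n : ℝ) / 2))]
        · simp
        · intro τ hτ
          rw [uIcc_of_le hb1.le] at hτ
          have h := Real.hasDerivAt_rpow_const (p := 1 - (n : ℝ) / 2)
            (Or.inl (hb0.trans_le hτ.1).ne')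
          rwa [show 1 - (n : ℝ) / 2 - 1 = -(n : ℝ) / 2 by ring] at h
        · refine ContinuousOn.intervalIntegrable fun τ hτ => ?_
          rw [uIcc_of_le hb1.le] at hτ
          exact (continuousAt_const.mul (Real.continuousAt_rpow_const _ _
            (Or.inl (hb0.trans_le hτ.1).ne'))).continuousWithinAt
      rw [intervalIntegral.integral_const_mul] at h4
      rw [h3]
      linarith
    rw [h2, indicator_of_mem (show σ ∈ Iio 1 from h1)]
    rcases le_or_gt σ a with h | h
    · rw [annulusWeight, indicator_of_notMem (fun h' => absurd h'.1 (not_lt.2 h)),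
        indicator_of_mem (show σ ∈ Iic a from h), hb, max_eq_right h]
      ring
    · have h5 : σ ^ (1 - (n : ℝ) / 2) = σ ^ (-(n : ℝ) / 2) * σ := by
        rw [← Real.rpow_add_one (ha.trans h).ne']
        congr 1; ring
      rw [annulusWeight, indicator_of_mem (show σ ∈ Ioo a 1 from ⟨h, h1⟩),
        indicator_of_notMem (by simpa using h), hb, max_eq_left h.le, h5]
      ring

theorem annulusWeight_nonneg {a : ℝ} (ha : 0 < a) (σ : ℝ) : 0 ≤ annulusWeight n a σ :=
  indicator_nonneg (fun _ hτ => Real.rpow_nonneg (ha.trans hτ.1).le _) σ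

theorem annulusWeight_le {a : ℝ} (ha : 0 < a) (σ : ℝ) :
    annulusWeight n a σ ≤ a ^ (-(n : ℝ) / 2) := by
  by_cases hσ : σ ∈ Ioo a 1
  · rw [annulusWeight, indicator_of_mem hσ]
    exact Real.rpow_le_rpow_of_nonpos ha hσ.1.le (by
      have : (0 : ℝ) ≤ n := Nat.cast_nonneg n
      linarith)
  · rw [annulusWeight, indicator_of_notMem hσ]
    positivity

theorem contDiff_annulusCutoff_mul_rpow {a : ℝ} (ha : 0 < a) (k : ℕ) :
    ContDiff ℝ ∞ fun τ : ℝ => annulusCutoff a k τ * τ ^ (-(n : ℝ) / 2) := by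
  rw [contDiff_iff_contDiffAt]
  intro τ
  rcases lt_or_ge τ a with h | h
  · refine contDiffAt_const (c := (0 : ℝ)) |>.congr_of_eventuallyEq ?_
    filter_upwards [Iio_mem_nhds h] with σ hσ
    rw [annulusCutoff_of_notMem k (fun h' => absurd h'.1 (not_lt.2 (le_of_lt hσ))), zero_mul]
  · exact (contDiff_annulusCutoff a k).contDiffAt.mul
      (Real.contDiffAt_rpow_const_of_ne (ha.trans_le h).ne')

theorem annulusCutoff_mul_rpow_eq {a : ℝ} (k : ℕ) (τ : ℝ) :
    annulusCutoff a k τ * τ ^ (-(n : ℝ) / 2) = annulusCutoff a k τ * annulusWeight n a τ := by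
  by_cases h : τ ∈ Ioo a 1
  · rw [annulusWeight, indicator_of_mem h]
  · rw [annulusCutoff_of_notMem k h, zero_mul, zero_mul]

theorem tendsto_annulusCutoff_mul {a : ℝ} (τ : ℝ) :
    Tendsto (fun k => annulusCutoff a k τ * annulusWeight n a τ) atTop (𝓝 (annulusWeight n a τ)) := by
  by_cases h : τ ∈ Ioo a 1
  · simpa using (tendsto_annulusCutoff h).mul_const (annulusWeight n a τ)
  · simp [annulusWeight, indicator_of_notMem h]

theorem measurable_annulusWeight (n : ℕ) (a : ℝ) : Measurable (annulusWeight n a) :=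
  (measurable_id.pow_const _).indicator measurableSet_Ioo

theorem integrableOn_annulusWeight_mul {a : ℝ} (ha : 0 < a)
    (hG : ∀ i, MemLp (fun x => G x i) 2 (volume.restrict (ball (0 : Euc n) 2))) :
    IntegrableOn (fun x => annulusWeight n a (‖x‖ ^ 2) * ‖eulerDeriv G x‖ ^ 2) (ball 0 2) := by
  refine Integrable.mono' ((integrableOn_energyDensity hG).const_mul (a ^ (-(n : ℝ) / 2) * 4)) ?_ ?_
  · exact ((measurable_annulusWeight n a).comp (by fun_prop)).aestronglyMeasurable.mul
      ((aestronglyMeasurable_eulerDeriv hG).norm.pow 2)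
  · filter_upwards [ae_restrict_mem measurableSet_ball] with x hx
    have hx2 : ‖x‖ ^ 2 ≤ 4 := by
      have : ‖x‖ < 2 := by simpa using hx
      nlinarith [norm_nonneg x]
    have h1 := energyDensity_nonneg G x
    have h2 := annulusWeight_nonneg (n := n) ha (‖x‖ ^ 2)
    rw [Real.norm_of_nonneg (by positivity), mul_assoc]
    refine mul_le_mul (annulusWeight_le ha _) ?_ (by positivity) (by positivity)
    exact (norm_eulerDeriv_sq_le G x).trans (by gcongr)

/-- The monotonicity formula: the increment of the normalized energy is the weighted `L²` norm of
the radial derivative on the annulus. -/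
theorem IsDomainStationary.theta_sub_theta (hst : IsDomainStationary (ball (0 : Euc n) 2) G)
    (hG : ∀ i, MemLp (fun x => G x i) 2 (volume.restrict (ball (0 : Euc n) 2)))
    {r : ℝ} (hr : 0 < r) (hr1 : r < 1) :
    theta G 0 1 - theta G 0 r
      = 2 * ∫ x in ball (0 : Euc n) 2, annulusWeight n (r ^ 2) (‖x‖ ^ 2) * ‖eulerDeriv G x‖ ^ 2 := by
  set a : ℝ := r ^ 2 with ha
  have ha0 : 0 < a := by positivity
  have ha1 : a < 1 := pow_lt_one₀ hr.le hr1 two_ne_zero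
  -- `annulusWeight` is not continuous: the first variation formula is used for primitives of its
  -- smooth cutoffs, and the limit is taken by dominated convergence
  set C : ℝ := a ^ (-(n : ℝ) / 2) with hC
  have hC0 : 0 ≤ C := by positivity
  set κ : ℕ → ℝ → ℝ := fun k τ => annulusCutoff a k τ * annulusWeight n a τ with hκ
  have hκs : ∀ k, ContDiff ℝ ∞ (κ k) := fun k => by
    simpa only [annulusCutoff_mul_rpow_eq] using
      contDiff_annulusCutoff_mul_rpow (n := n) ha0 k
  have hκ0 : ∀ k τ, 0 ≤ κ k τ := fun k τ =>
    mul_nonneg (annulusCutoff_nonneg _ _ _) (annulusWeight_nonneg ha0 _)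
  have hκC : ∀ k τ, κ k τ ≤ C := fun k τ =>
    (mul_le_of_le_one_left (annulusWeight_nonneg ha0 _) (annulusCutoff_le_one _ _ _)).trans
      (annulusWeight_le ha0 _)
  set P : ℕ → ℝ → ℝ := fun k σ => -(1 / 2) * ∫ τ in (1 : ℝ)..σ, κ k τ with hP
  have hPd : ∀ k σ, HasDerivAt (P k) (-(1 / 2) * κ k σ) σ := fun k σ =>
    ((hκs k).continuous.integral_hasStrictDerivAt 1 σ).hasDerivAt.const_mul _
  have hPs : ∀ k, ContDiff ℝ ∞ (P k) := fun k => by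
    rw [contDiff_infty_iff_deriv]
    refine ⟨fun σ => (hPd k σ).differentiableAt, ?_⟩
    rw [funext fun σ => (hPd k σ).deriv]
    exact contDiff_const.mul (hκs k)
  have hP1 : ∀ k σ, 1 ≤ σ → P k σ = 0 := fun k σ hσ => by
    simp only [hP]
    rw [intervalIntegral.integral_congr (g := fun _ => 0)]
    · simp
    · intro τ hτ
      rw [uIcc_of_le hσ] at hτ
      simp only [hκ]
      rw [annulusCutoff_of_notMem k (fun h => absurd h.2 (not_lt.2 hτ.1)), zero_mul]
  have hPC : ∀ k σ, 0 ≤ σ → |P k σ| ≤ C := fun k σ hσ => by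
    rcases le_total 1 σ with h | h
    · rw [hP1 k σ h]; simpa using hC0
    · have h1 : ‖∫ τ in (1 : ℝ)..σ, κ k τ‖ ≤ C * |σ - 1| :=
        intervalIntegral.norm_integral_le_of_norm_le_const fun τ _ => by
          rw [Real.norm_of_nonneg (hκ0 k τ)]; exact hκC k τ
      have h2 : |σ - 1| ≤ 1 := by rw [abs_le]; constructor <;> linarith
      simp only [hP, abs_mul]
      rw [Real.norm_eq_abs] at h1
      have h3 : |(-(1 / 2) : ℝ)| = 1 / 2 := by norm_num
      rw [h3]
      nlinarith [abs_nonneg (∫ τ in (1 : ℝ)..σ, κ k τ)]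
  have he := integrableOn_energyDensity hG
  have hR := aestronglyMeasurable_eulerDeriv hG
  have hlim : Tendsto (fun k => ∫ x in ball (0 : Euc n) 2,
      ((((n : ℝ) - 2) * P k (‖x‖ ^ 2) + 2 * (-(1 / 2) * κ k (‖x‖ ^ 2)) * ‖x‖ ^ 2)
      * energyDensity G x - 4 * (-(1 / 2) * κ k (‖x‖ ^ 2)) * ‖eulerDeriv G x‖ ^ 2)) atTop
      (𝓝 (∫ x in ball (0 : Euc n) 2, (((n : ℝ) - 2) *
        (-(1 / 2) * ∫ τ in (1 : ℝ)..‖x‖ ^ 2, annulusWeight n a τ)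
          + 2 * (-(1 / 2) * annulusWeight n a (‖x‖ ^ 2)) * ‖x‖ ^ 2) * energyDensity G x
          - 4 * (-(1 / 2) * annulusWeight n a (‖x‖ ^ 2)) * ‖eulerDeriv G x‖ ^ 2)) := by
    refine tendsto_integral_of_dominated_convergence
      (fun x => (|(n : ℝ) - 2| * C + C * 4 + 2 * C * 4) * energyDensity G x) ?_
      (he.const_mul _) ?_ ?_
    · intro k
      have hc1 : Continuous fun x : Euc n =>
          ((n : ℝ) - 2) * P k (‖x‖ ^ 2) + 2 * (-(1 / 2) * κ k (‖x‖ ^ 2)) * ‖x‖ ^ 2 := by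
        have := (hPs k).continuous
        have := (hκs k).continuous
        fun_prop
      have hc2 : Continuous fun x : Euc n => 4 * (-(1 / 2) * κ k (‖x‖ ^ 2)) := by
        have := (hκs k).continuous
        fun_prop
      exact (hc1.aestronglyMeasurable.mul he.1).sub (hc2.aestronglyMeasurable.mul (hR.norm.pow 2))
    · intro k
      filter_upwards [ae_restrict_mem measurableSet_ball] with x hx
      have hx2 : ‖x‖ ^ 2 ≤ 4 := by
        have : ‖x‖ < 2 := by simpa using hx
        nlinarith [norm_nonneg x]
      have h0 := energyDensity_nonneg G x
      have h1 := hPC k _ (sq_nonneg ‖x‖)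
      have h2 := hκ0 k (‖x‖ ^ 2)
      have h3 := hκC k (‖x‖ ^ 2)
      have h4 : ‖eulerDeriv G x‖ ^ 2 ≤ 4 * energyDensity G x :=
        (norm_eulerDeriv_sq_le G x).trans (by gcongr)
      have h5 : |((n : ℝ) - 2) * P k (‖x‖ ^ 2) + 2 * (-(1 / 2) * κ k (‖x‖ ^ 2)) * ‖x‖ ^ 2|
          ≤ |(n : ℝ) - 2| * C + C * 4 := by
        refine (abs_add_le _ _).trans (add_le_add ?_ ?_)
        · rw [abs_mul]; gcongr
        · rw [show 2 * (-(1 / 2) * κ k (‖x‖ ^ 2)) * ‖x‖ ^ 2 = -(κ k (‖x‖ ^ 2) * ‖x‖ ^ 2) by ring,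
            abs_neg, abs_of_nonneg (by positivity)]
          gcongr
      rw [Real.norm_eq_abs]
      refine (abs_sub _ _).trans ?_
      rw [abs_mul, abs_of_nonneg h0, add_mul _ (2 * C * 4)]
      refine add_le_add (by gcongr) ?_
      rw [show 4 * (-(1 / 2) * κ k (‖x‖ ^ 2)) * ‖eulerDeriv G x‖ ^ 2
        = -(2 * κ k (‖x‖ ^ 2) * ‖eulerDeriv G x‖ ^ 2) by ring, abs_neg,
        abs_of_nonneg (by positivity)]
      calc 2 * κ k (‖x‖ ^ 2) * ‖eulerDeriv G x‖ ^ 2 ≤ 2 * C * (4 * energyDensity G x) := by gcongr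
        _ = _ := by ring
    · refine Eventually.of_forall fun x => ?_
      have h1 : Tendsto (fun k => κ k (‖x‖ ^ 2)) atTop (𝓝 (annulusWeight n a (‖x‖ ^ 2))) :=
        tendsto_annulusCutoff_mul _
      have h2 : Tendsto (fun k => ∫ τ in (1 : ℝ)..‖x‖ ^ 2, κ k τ) atTop
          (𝓝 (∫ τ in (1 : ℝ)..‖x‖ ^ 2, annulusWeight n a τ)) := by
        refine intervalIntegral.tendsto_integral_filter_of_dominated_convergence (fun _ => C)
          (Eventually.of_forall fun k => (hκs k).continuous.aestronglyMeasurable)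
          (Eventually.of_forall fun k => Eventually.of_forall fun τ _ => ?_)
          intervalIntegrable_const (Eventually.of_forall fun τ _ => tendsto_annulusCutoff_mul _)
        rw [Real.norm_of_nonneg (hκ0 k τ)]; exact hκC k τ
      exact ((((h2.const_mul _).const_mul _).add (((h1.const_mul _).const_mul _).mul_const _)).mul_const
        _).sub (((h1.const_mul _).const_mul _).mul_const _)
  have hzero := tendsto_nhds_unique hlim (by
    simp only [hst.integral_radial_eq_zero (hPs _) (hPd _) (hP1 _)]
    exact tendsto_const_nhds)
  have hpt : ∀ x : Euc n, (((n : ℝ) - 2) *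
        (-(1 / 2) * ∫ τ in (1 : ℝ)..‖x‖ ^ 2, annulusWeight n a τ)
          + 2 * (-(1 / 2) * annulusWeight n a (‖x‖ ^ 2)) * ‖x‖ ^ 2) * energyDensity G x
          - 4 * (-(1 / 2) * annulusWeight n a (‖x‖ ^ 2)) * ‖eulerDeriv G x‖ ^ 2
      = ((closedBall 0 r).indicator (fun x => a ^ (1 - (n : ℝ) / 2) * energyDensity G x) x
        - (ball 0 1).indicator (energyDensity G) x)
        + 2 * (annulusWeight n a (‖x‖ ^ 2) * ‖eulerDeriv G x‖ ^ 2) := by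
    intro x
    have h1 := sub_two_mul_integral_annulusWeight (n := n) (σ := ‖x‖ ^ 2) ha0 ha1
    have h2 : (closedBall 0 r).indicator (fun x => a ^ (1 - (n : ℝ) / 2) * energyDensity G x) x
        = (Iic a).indicator (fun _ => a ^ (1 - (n : ℝ) / 2)) (‖x‖ ^ 2) * energyDensity G x := by
      have : x ∈ closedBall (0 : Euc n) r ↔ ‖x‖ ^ 2 ∈ Iic a := by
        rw [mem_closedBall_zero_iff, mem_Iic, ha, sq_le_sq₀ (norm_nonneg _) hr.le]
      by_cases h : x ∈ closedBall (0 : Euc n) r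
      · rw [indicator_of_mem h, indicator_of_mem (this.1 h)]
      · rw [indicator_of_notMem h, indicator_of_notMem (fun h' => h (this.2 h')), zero_mul]
    have h3 : (ball 0 1).indicator (energyDensity G) x
        = (Iio 1).indicator (fun _ => 1) (‖x‖ ^ 2) * energyDensity G x := by
      have : x ∈ ball (0 : Euc n) 1 ↔ ‖x‖ ^ 2 ∈ Iio (1 : ℝ) := by
        rw [mem_ball_zero_iff, mem_Iio, sq_lt_one_iff₀ (norm_nonneg _)]
      by_cases h : x ∈ ball (0 : Euc n) 1
      · rw [indicator_of_mem h, indicator_of_mem (this.1 h), one_mul]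
      · rw [indicator_of_notMem h, indicator_of_notMem (fun h' => h (this.2 h')), zero_mul]
    rw [h2, h3]
    linear_combination energyDensity G x * h1
  simp only [hpt] at hzero
  have hr2 : closedBall (0 : Euc n) r ⊆ ball 0 2 := closedBall_subset_ball (by linarith)
  have h12 : ball (0 : Euc n) 1 ⊆ ball 0 2 := ball_subset_ball (by norm_num)
  have hi1 : IntegrableOn ((closedBall 0 r).indicator
      (fun x => a ^ (1 - (n : ℝ) / 2) * energyDensity G x)) (ball 0 2) :=
    Integrable.indicator (he.const_mul _) measurableSet_closedBall
  have hi2 : IntegrableOn ((ball 0 1).indicator (energyDensity G)) (ball 0 2) :=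
    he.indicator measurableSet_ball
  have hi3 := (integrableOn_annulusWeight_mul ha0 hG).const_mul 2
  rw [integral_add (by exact hi1.sub hi2) hi3, integral_sub hi1 hi2, integral_const_mul,
    setIntegral_indicator measurableSet_closedBall, setIntegral_indicator measurableSet_ball,
    inter_eq_self_of_subset_right hr2, inter_eq_self_of_subset_right h12,
    integral_const_mul] at hzero
  have hsph : ∫ x in closedBall (0 : Euc n) r, energyDensity G x
      = ∫ x in ball (0 : Euc n) r, energyDensity G x := by
    rw [← ball_union_sphere]
    refine setIntegral_congr_set ?_
    have h := ae_eq_empty.2 (Measure.addHaar_sphere_of_ne_zero volume (0 : Euc n) hr.ne')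
    simpa using (ae_eq_refl (ball (0 : Euc n) r)).union h
  have hpow : a ^ (1 - (n : ℝ) / 2) = r ^ (2 - (n : ℤ)) := by
    rw [ha, ← Real.rpow_natCast, ← Real.rpow_mul hr.le, ← Real.rpow_intCast]
    congr 1; push_cast; ring
  rw [hsph, hpow] at hzero
  simp only [theta, energy, one_zpow, one_mul]
  linarith

end Monotonicity

/-! ### Sobolev maps under dilations -/

section Dilation

variable {n K : ℕ}

/-- `R` is the weak derivative of `u` along the position vector field on `Ω`. Since the divergence
of that field is `n`, its formal adjoint is `ψ ↦ -(n ψ + ∂_x ψ)`. -/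
def IsWeakEulerDeriv (Ω : Set (Euc n)) (u R : Euc n → Euc K) : Prop :=
  ∀ ψ : Euc n → ℝ, ContDiff ℝ ∞ ψ → HasCompactSupport ψ → tsupport ψ ⊆ Ω →
    ∫ y, (n * ψ y + fderiv ℝ ψ y y) • u y = - ∫ y, ψ y • R y

theorem IsSobolev.integrableOn {s : Set (Euc n)} {u : Euc n → Euc K} {G : Euc n → Fin n → Euc K}
    (h : IsSobolev s u G) (hs : volume s ≠ ⊤) : IntegrableOn u s := by
  have : IsFiniteMeasure (volume.restrict s) := isFiniteMeasure_restrict.2 hs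
  exact h.memLp.integrable (by norm_num)

theorem IsSobolev.integrableOn_grad {s : Set (Euc n)} {u : Euc n → Euc K}
    {G : Euc n → Fin n → Euc K} (h : IsSobolev s u G) (hs : volume s ≠ ⊤) (i : Fin n) :
    IntegrableOn (fun x => G x i) s := by
  have : IsFiniteMeasure (volume.restrict s) := isFiniteMeasure_restrict.2 hs
  exact (h.memLp_grad i).integrable (by norm_num)

theorem IsSobolev.isWeakEulerDeriv {Ω : Set (Euc n)} {u : Euc n → Euc K}
    {G : Euc n → Fin n → Euc K} (hΩ : MeasurableSet Ω) (hΩ' : volume Ω ≠ ⊤)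
    (h : IsSobolev Ω u G) :
    IsWeakEulerDeriv Ω (Ω.indicator u) (Ω.indicator (eulerDeriv G)) := by
  intro ψ hψ hψc hψs
  set ψi : Fin n → Euc n → ℝ := fun i y => y i * ψ y with hψi
  have hcoord : ∀ i : Fin n, ContDiff ℝ ∞ fun y : Euc n => y i := fun i => by fun_prop
  have hψis : ∀ i, ContDiff ℝ ∞ (ψi i) := fun i => (hcoord i).mul hψ
  have hψic : ∀ i, HasCompactSupport (ψi i) := fun i => hψc.mul_left
  have hψit : ∀ i, tsupport (ψi i) ⊆ Ω := fun i => (tsupport_mul_subset_right).trans hψs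
  have hd : ∀ i y, fderiv ℝ (ψi i) y (basisVec i) = ψ y + y i * fderiv ℝ ψ y (basisVec i) := by
    intro i y
    have h1 : HasFDerivAt (fun y : Euc n => y i)
        (EuclideanSpace.proj i : Euc n →L[ℝ] ℝ) y :=
      (EuclideanSpace.proj i : Euc n →L[ℝ] ℝ).hasFDerivAt
    have h2 : HasFDerivAt (ψi i) _ y := h1.mul (hψ.differentiable (by simp) y).hasFDerivAt
    rw [h2.fderiv]
    simp [basisVec]
    ring
  have hsum : ∀ y, (n * ψ y + fderiv ℝ ψ y y) = ∑ i, fderiv ℝ (ψi i) y (basisVec i) := by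
    intro y
    have h1 : ∑ i, y i * fderiv ℝ ψ y (basisVec i) = fderiv ℝ ψ y y := by
      have h2 := congrArg (fderiv ℝ ψ y) ((EuclideanSpace.basisFun (Fin n) ℝ).sum_repr y)
      rw [map_sum] at h2
      simpa only [map_smul, smul_eq_mul, basisVec, EuclideanSpace.basisFun_repr,
        EuclideanSpace.basisFun_apply] using h2
    simp only [hd, Finset.sum_add_distrib, h1]
    simp
  have hu := h.integrableOn hΩ'
  have hint1 : ∀ i, Integrable (fun y => (fderiv ℝ (ψi i) y (basisVec i)) • u y)
      (volume.restrict Ω) := by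
    intro i
    have hc : Continuous fun y => fderiv ℝ (ψi i) y (basisVec i) :=
      ((hψis i).continuous_fderiv (by simp)).clm_apply continuous_const
    have hcs : HasCompactSupport fun y => fderiv ℝ (ψi i) y (basisVec i) :=
      (hψic i).fderiv_apply (𝕜 := ℝ) (basisVec i)
    obtain ⟨C, hC⟩ := hcs.exists_bound_of_continuous hc
    exact hu.bdd_smul C hc.aestronglyMeasurable (Eventually.of_forall hC)
  have hint2 : ∀ i, Integrable (fun y => ψi i y • G y i) (volume.restrict Ω) := by
    intro i
    obtain ⟨C, hC⟩ := (hψic i).exists_bound_of_continuous (hψis i).continuous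
    exact (h.integrableOn_grad hΩ' i).bdd_smul C (hψis i).continuous.aestronglyMeasurable
      (Eventually.of_forall hC)
  have hl : ∫ y, (n * ψ y + fderiv ℝ ψ y y) • Ω.indicator u y
      = ∑ i, ∫ y in Ω, (fderiv ℝ (ψi i) y (basisVec i)) • u y := by
    rw [← integral_finsetSum _ fun i _ => hint1 i, ← integral_indicator hΩ]
    refine integral_congr_ae (Eventually.of_forall fun y => ?_)
    by_cases hy : y ∈ Ω
    · simp [hy, hsum, Finset.sum_smul]
    · simp [hy]
  have hr : ∫ y, ψ y • Ω.indicator (eulerDeriv G) y = ∑ i, ∫ y in Ω, ψi i y • G y i := by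
    rw [← integral_finsetSum _ fun i _ => hint2 i, ← integral_indicator hΩ]
    refine integral_congr_ae (Eventually.of_forall fun y => ?_)
    by_cases hy : y ∈ Ω
    · simp [hy, eulerDeriv, Finset.smul_sum, hψi, smul_smul, mul_comm]
    · simp [hy]
  rw [hl, hr, ← Finset.sum_neg_distrib]
  exact Finset.sum_congr rfl fun i _ => h.weakGradient (ψi i) (hψis i) (hψic i) (hψit i) i

variable {u R : Euc n → Euc K}

/-- The pairing of `u` with a rescaled test function is differentiable in the scale, although `u`
need not be differentiable along rays: the derivative falls on the test function, and the
definition of `R` moves it back to `u`. -/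
theorem IsWeakEulerDeriv.hasDerivAt_integral_comp_smul (h : IsWeakEulerDeriv (ball 0 2) u R)
    (hn : n ≠ 0) (hu : Integrable u) (hu0 : ∀ x ∉ ball (0 : Euc n) 2, u x = 0)
    {φ : Euc n → ℝ} (hφ : ContDiff ℝ ∞ φ) (hφc : HasCompactSupport φ)
    (hφs : tsupport φ ⊆ ball 0 1) {s : ℝ} (hs : 1 / 2 < s) :
    HasDerivAt (fun s : ℝ => ∫ y, (s ^ n * φ (s • y)) • u y)
      (-(s ^ (n - 1) • ∫ y, φ (s • y) • R y)) s := by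
  have hs0 : 0 < s := by linarith
  obtain ⟨C₀, hC₀⟩ := hφc.exists_bound_of_continuous hφ.continuous
  obtain ⟨C₁, hC₁⟩ := (hφc.fderiv ℝ).exists_bound_of_continuous (hφ.continuous_fderiv (by simp))
  have hC₀0 : 0 ≤ C₀ := (norm_nonneg _).trans (hC₀ 0)
  have hC₁0 : 0 ≤ C₁ := (norm_nonneg _).trans (hC₁ 0)
  have hd : ∀ (s : ℝ) (y : Euc n), HasDerivAt (fun s : ℝ => s ^ n * φ (s • y))
      (n * s ^ (n - 1) * φ (s • y) + s ^ n * fderiv ℝ φ (s • y) y) s := by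
    intro s y
    have h1 : HasDerivAt (fun s : ℝ => s • y) y s := by simpa using (hasDerivAt_id s).smul_const y
    exact (hasDerivAt_pow n s).mul
      ((hφ.differentiable (by simp) (s • y)).hasFDerivAt.comp_hasDerivAt s h1)
  have hcφ : Continuous φ := hφ.continuous
  have hcDφ : Continuous (fderiv ℝ φ) := hφ.continuous_fderiv (by simp)
  have hmeas : ∀ s : ℝ, AEStronglyMeasurable (fun y => (s ^ n * φ (s • y)) • u y) volume := fun s =>
    (by fun_prop : Continuous fun y : Euc n => s ^ n * φ (s • y)).aestronglyMeasurable.smul hu.1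
  have key := (hasDerivAt_integral_of_dominated_loc_of_deriv_le (μ := volume) (x₀ := s)
    (F := fun s y => (s ^ n * φ (s • y)) • u y)
    (F' := fun s y => (n * s ^ (n - 1) * φ (s • y) + s ^ n * fderiv ℝ φ (s • y) y) • u y)
    (bound := fun y => (n * (s + 1) ^ (n - 1) * C₀ + (s + 1) ^ n * (C₁ * 2)) * ‖u y‖)
    (Ioo_mem_nhds hs0 (lt_add_one s)) (Eventually.of_forall hmeas)
    (hu.bdd_smul (s ^ n * C₀) (by fun_prop : Continuous fun y : Euc n =>
      s ^ n * φ (s • y)).aestronglyMeasurable (Eventually.of_forall fun y => by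
        rw [norm_mul, Real.norm_of_nonneg (by positivity)]; gcongr; exact hC₀ _))
    ((by fun_prop : Continuous fun y : Euc n => n * s ^ (n - 1) * φ (s • y)
      + s ^ n * fderiv ℝ φ (s • y) y).aestronglyMeasurable.smul hu.1)
    (Eventually.of_forall fun y σ hσ => by
      have hσ0 := hσ.1.le
      have hσ1 := hσ.2.le
      by_cases hy : y ∈ ball (0 : Euc n) 2
      · rw [norm_smul]
        gcongr
        refine (norm_add_le _ _).trans (add_le_add ?_ ?_)
        · rw [norm_mul, Real.norm_of_nonneg (by positivity)]
          gcongr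
          exact hC₀ _
        · rw [norm_mul, Real.norm_of_nonneg (by positivity)]
          gcongr
          refine ((fderiv ℝ φ (σ • y)).le_opNorm y).trans ?_
          gcongr
          · exact hC₁ _
          · exact (mem_ball_zero_iff.1 hy).le
      · simp [hu0 y hy])
    (hu.norm.const_mul _)
    (Eventually.of_forall fun y σ _ => (hd σ y).smul_const (u y))).2
  refine key.congr_deriv ?_
  -- this is where `1 / 2 < s` is used
  have hφs' : tsupport (fun y => φ (s • y)) ⊆ ball (0 : Euc n) 2 := by
    intro y hy
    have h1 : s • y ∈ tsupport φ := tsupport_comp_subset_preimage φ (continuous_const_smul s) hy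
    have h2 := mem_ball_zero_iff.1 (hφs h1)
    rw [norm_smul, Real.norm_of_nonneg hs0.le] at h2
    rw [mem_ball_zero_iff]
    nlinarith [norm_nonneg y]
  have h1 := h (fun y => φ (s • y)) (hφ.comp (contDiff_const_smul s))
    (hφc.comp_smul hs0.ne') hφs'
  rw [← smul_neg, ← h1, ← integral_smul]
  refine integral_congr_ae (Eventually.of_forall fun y => ?_)
  have h2 : fderiv ℝ (fun y => φ (s • y)) y y = s * fderiv ℝ φ (s • y) y := by
    have h3 : HasFDerivAt (fun y : Euc n => s • y) (s • ContinuousLinearMap.id ℝ (Euc n)) y :=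
      (hasFDerivAt_id y).const_smul s
    have h4 : HasFDerivAt (fun y => φ (s • y)) _ y :=
      (hφ.differentiable (by simp) (s • y)).hasFDerivAt.comp y h3
    rw [h4.fderiv]
    simp
  obtain ⟨d, rfl⟩ := Nat.exists_eq_succ_of_ne_zero hn
  simp only [h2, smul_smul, Nat.succ_eq_add_one, Nat.add_sub_cancel]
  congr 1
  push_cast
  ring

/-- The derivative of `c ↦ u (c x)` in the sense of distributions in `x`: formally it is
`R (c x) / c`, since `R` is the derivative along the position field. -/
theorem IsWeakEulerDeriv.hasDerivAt_integral_comp_dilation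
    (h : IsWeakEulerDeriv (ball 0 2) u R)
    (hn : n ≠ 0) (hu : Integrable u) (hu0 : ∀ x ∉ ball (0 : Euc n) 2, u x = 0)
    {φ : Euc n → ℝ} (hφ : ContDiff ℝ ∞ φ) (hφc : HasCompactSupport φ)
    (hφs : tsupport φ ⊆ ball 0 1) {c : ℝ} (hc : 0 < c) (hc2 : c < 2) :
    HasDerivAt (fun c : ℝ => ∫ x, φ x • u (c • x)) (∫ x, φ x • c⁻¹ • R (c • x)) c := by
  have hcv : ∀ (v : Euc n → Euc K) (c : ℝ), 0 < c →
      ∫ x, φ x • v (c • x) = (c⁻¹) ^ n • ∫ y, φ (c⁻¹ • y) • v y := by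
    intro v c hc
    have h1 := Measure.integral_comp_smul volume (fun x => φ (c⁻¹ • x) • v x) c
    simp only [smul_smul, inv_mul_cancel₀ hc.ne', one_smul] at h1
    rw [h1, finrank_euclideanSpace, Fintype.card_fin, abs_of_nonneg (by positivity), inv_pow]
  have h1 : HasDerivAt (fun c : ℝ => ∫ x, φ x • u (c • x)) _ c :=
    ((h.hasDerivAt_integral_comp_smul hn hu hu0 hφ hφc hφs (s := c⁻¹) (by
      rw [one_div]; exact inv_strictAnti₀ hc hc2)).scomp c (hasDerivAt_inv hc.ne')).congr_of_eventuallyEq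
      (by
        filter_upwards [Ioi_mem_nhds hc] with σ hσ
        rw [hcv u σ hσ, ← integral_smul]
        simp [smul_smul])
  convert h1 using 1
  have h2 : ∀ x, φ x • c⁻¹ • R (c • x) = c⁻¹ • (φ x • R (c • x)) := fun x => smul_comm _ _ _
  simp only [h2]
  rw [integral_smul, hcv R c hc, smul_neg, neg_smul, neg_neg, smul_smul, smul_smul]
  congr 1
  obtain ⟨d, rfl⟩ := Nat.exists_eq_succ_of_ne_zero hn
  simp only [Nat.succ_eq_add_one, Nat.add_sub_cancel]
  rw [← inv_pow]
  ring

theorem integrable_prod_dilation (hR : Integrable R) (hRm : StronglyMeasurable R) {c : ℝ}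
    (hc : 0 < c) :
    Integrable (fun p : ℝ × Euc n => p.1⁻¹ • R (p.1 • p.2))
      ((volume.restrict (Ioc c 1)).prod volume) := by
  have hm : StronglyMeasurable fun p : ℝ × Euc n => p.1⁻¹ • R (p.1 • p.2) :=
    (measurable_fst.inv.stronglyMeasurable).smul (hRm.comp_measurable (by fun_prop))
  rw [integrable_prod_iff hm.aestronglyMeasurable]
  constructor
  · filter_upwards [ae_restrict_mem measurableSet_Ioc] with σ hσ
    have h1 : Integrable fun x => R (σ • x) := hR.comp_smul (hc.trans hσ.1).ne'
    exact h1.smul σ⁻¹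
  · refine Integrable.mono' (integrable_const (c⁻¹ * ((c ^ n)⁻¹ * ∫ x, ‖R x‖)))
      (hm.norm.integral_prod_right (ν := volume)).aestronglyMeasurable ?_
    filter_upwards [ae_restrict_mem measurableSet_Ioc] with σ hσ
    have hσ0 := hc.trans hσ.1
    rw [Real.norm_of_nonneg (integral_nonneg fun _ => norm_nonneg _)]
    have h1 : ∀ x, ‖σ⁻¹ • R (σ • x)‖ = σ⁻¹ * ‖R (σ • x)‖ := fun x => by
      rw [norm_smul, Real.norm_of_nonneg (by positivity)]
    simp only [h1]
    rw [integral_const_mul, Measure.integral_comp_smul volume (fun x => ‖R x‖) σ,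
      finrank_euclideanSpace, Fintype.card_fin, abs_of_nonneg (by positivity), smul_eq_mul]
    have hσc := hσ.1.le
    gcongr

/-- For a fixed factor `c`, the increment of a Sobolev map between `c x` and `x` is obtained by
integrating its derivative over the dilations in between, for almost every `x`. -/
theorem IsWeakEulerDeriv.ae_sub_eq_integral (h : IsWeakEulerDeriv (ball 0 2) u R)
    (hn : n ≠ 0) (hu : Integrable u) (hu0 : ∀ x ∉ ball (0 : Euc n) 2, u x = 0)
    (hR : Integrable R) (hRm : StronglyMeasurable R) {c : ℝ} (hc : 0 < c) (hc1 : c ≤ 1) :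
    ∀ᵐ x, x ∈ ball (0 : Euc n) 1 → u x - u (c • x) = ∫ σ in c..1, σ⁻¹ • R (σ • x) := by
  have hprod := integrable_prod_dilation hR hRm hc
  have hi1 : Integrable fun x => u (c • x) := hu.comp_smul hc.ne'
  have hi2 : Integrable fun x => ∫ σ in c..1, σ⁻¹ • R (σ • x) := by
    simp only [intervalIntegral.integral_of_le hc1]
    exact hprod.integral_prod_right
  have hi := (hu.sub hi1).sub hi2
  have key := isOpen_ball.ae_eq_zero_of_integral_contDiff_smul_eq_zero
    (U := ball (0 : Euc n) 1) (μ := volume) (hi.locallyIntegrable.locallyIntegrableOn _) (by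
      intro φ hφ hφc hφs
      obtain ⟨C, hC⟩ := hφc.exists_bound_of_continuous hφ.continuous
      have hφm : AEStronglyMeasurable φ volume := hφ.continuous.aestronglyMeasurable
      have hb : ∀ {v : Euc n → Euc K}, Integrable v → Integrable fun x => φ x • v x :=
        fun hv => hv.bdd_smul C hφm (Eventually.of_forall hC)
      have hφprod : Integrable (fun p : ℝ × Euc n => φ p.2 • p.1⁻¹ • R (p.1 • p.2))
          ((volume.restrict (Ioc c 1)).prod volume) :=
        hprod.bdd_smul C (hφ.continuous.comp continuous_snd).aestronglyMeasurable
          (Eventually.of_forall fun p => hC p.2)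
      have hftc : ∫ σ in c..1, ∫ x, φ x • σ⁻¹ • R (σ • x)
          = (∫ x, φ x • u ((1 : ℝ) • x)) - ∫ x, φ x • u (c • x) := by
        refine intervalIntegral.integral_eq_sub_of_hasDerivAt
          (f := fun c : ℝ => ∫ x, φ x • u (c • x)) (fun σ hσ => ?_) ?_
        · rw [uIcc_of_le hc1] at hσ
          exact h.hasDerivAt_integral_comp_dilation hn hu hu0 hφ hφc hφs
            (hc.trans_le hσ.1) (hσ.2.trans_lt one_lt_two)
        · rw [intervalIntegrable_iff_integrableOn_Ioc_of_le hc1]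
          exact hφprod.integral_prod_left
      have hfub : ∫ σ in c..1, ∫ x, φ x • σ⁻¹ • R (σ • x)
          = ∫ x, φ x • ∫ σ in c..1, σ⁻¹ • R (σ • x) := by
        simp only [intervalIntegral.integral_of_le hc1]
        rw [integral_integral_swap hφprod]
        simp only [integral_smul]
      have h1 : ∀ x, φ x • ((u - fun x => u (c • x)) - fun x => ∫ σ in c..1, σ⁻¹ • R (σ • x)) x
          = φ x • u x - φ x • u (c • x) - φ x • ∫ σ in c..1, σ⁻¹ • R (σ • x) := by
        intro x; simp [smul_sub]
      simp only [h1]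
      rw [integral_sub (by exact (hb hu).sub (hb hi1)) (hb hi2), integral_sub (hb hu) (hb hi1), ← hfub, hftc]
      simp)
  filter_upwards [key] with x hx hxb
  exact sub_eq_zero.1 (hx hxb)

end Dilation

/-! ### Polar coordinates and pairs of radii -/

section Polar

variable {n K : ℕ}

/-- Integration in polar coordinates. In dimension `0` it fails, as the origin has positive
measure. -/
theorem lintegral_eq_lintegral_sphere (hn : n ≠ 0) {F : Euc n → ℝ≥0∞} (hF : Measurable F) :
    ∫⁻ x, F x = ∫⁻ w : sphere (0 : Euc n) 1, (∫⁻ t in Ioi (0 : ℝ),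
      ENNReal.ofReal (t ^ (n - 1)) * F (t • (w : Euc n))) ∂(volume : Measure (Euc n)).toSphere := by
  have : Nonempty (Fin n) := ⟨⟨0, Nat.pos_of_ne_zero hn⟩⟩
  have hmp := (volume : Measure (Euc n)).measurePreserving_homeomorphUnitSphereProd
  rw [finrank_euclideanSpace, Fintype.card_fin] at hmp
  have hm : Measurable fun p : sphere (0 : Euc n) 1 × Ioi (0 : ℝ) =>
      F ((p.2 : ℝ) • (p.1 : Euc n)) := hF.comp (by fun_prop)
  calc ∫⁻ x, F x = ∫⁻ x in ({0}ᶜ : Set (Euc n)), F x := by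
        rw [restrict_compl_singleton]
    _ = ∫⁻ x : ({0}ᶜ : Set (Euc n)), F x ∂(Measure.comap Subtype.val volume) :=
        (lintegral_subtype_comap (measurableSet_singleton _).compl F).symm
    _ = ∫⁻ p, F ((p.2 : ℝ) • (p.1 : Euc n))
          ∂((volume : Measure (Euc n)).toSphere.prod (Measure.volumeIoiPow (n - 1))) := by
        rw [← hmp.lintegral_comp_emb (Homeomorph.measurableEmbedding _)]
        refine lintegral_congr fun x => ?_
        have hx : ‖(x : Euc n)‖ ≠ 0 := norm_ne_zero_iff.2 x.2
        congr 1
        simp [smul_smul, hx]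
    _ = _ := by
        rw [lintegral_prod _ hm.aemeasurable]
        refine lintegral_congr fun w => ?_
        have hm1 : Measurable fun t : ℝ => F (t • (w : Euc n)) := hF.comp (by fun_prop)
        have h1 := lintegral_withDensity_eq_lintegral_mul (Measure.comap Subtype.val volume)
          (f := fun t : Ioi (0 : ℝ) => ENNReal.ofReal (t.1 ^ (n - 1))) (by fun_prop)
          (hm1.comp measurable_subtype_coe)
        exact h1.trans (lintegral_subtype_comap measurableSet_Ioi
          fun t : ℝ => ENNReal.ofReal (t ^ (n - 1)) * F (t • (w : Euc n)))

theorem ae_sphere_of_ae (hn : n ≠ 0) {p : Euc n → Prop} (h : ∀ᵐ x, p x) :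
    ∀ᵐ w : sphere (0 : Euc n) 1 ∂(volume : Measure (Euc n)).toSphere, ∀ᵐ t : ℝ,
      0 < t → p (t • (w : Euc n)) := by
  set T := toMeasurable volume {x | ¬ p x} with hT
  have hTm : MeasurableSet T := measurableSet_toMeasurable _ _
  have hT0 : volume T = 0 := by rw [hT, measure_toMeasurable]; exact h
  set F : Euc n → ℝ≥0∞ := T.indicator 1 with hF
  have hFm : Measurable F := measurable_one.indicator hTm
  have h1 := lintegral_eq_lintegral_sphere hn hFm
  rw [hF, lintegral_indicator_one hTm, hT0, eq_comm, lintegral_eq_zero_iff] at h1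
  · filter_upwards [h1] with w hw
    have hm : Measurable fun t : ℝ => ENNReal.ofReal (t ^ (n - 1)) * F (t • (w : Euc n)) :=
      (by fun_prop : Measurable fun t : ℝ => ENNReal.ofReal (t ^ (n - 1))).mul
        (hFm.comp (by fun_prop))
    have h2 := (lintegral_eq_zero_iff hm).1 hw
    filter_upwards [(ae_restrict_iff' measurableSet_Ioi).1 h2] with t ht ht0
    by_contra hcon
    have h3 : t • (w : Euc n) ∈ T := subset_toMeasurable _ _ hcon
    have h4 : 0 < ENNReal.ofReal (t ^ (n - 1)) := ENNReal.ofReal_pos.2 (pow_pos ht0 _)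
    have h5 := ht ht0
    simp [hF, h3, h4.ne'] at h5
  · have hm : Measurable fun q : sphere (0 : Euc n) 1 × ℝ =>
        ENNReal.ofReal (q.2 ^ (n - 1)) * F (q.2 • (q.1 : Euc n)) :=
      (by fun_prop : Measurable fun q : sphere (0 : Euc n) 1 × ℝ =>
        ENNReal.ofReal (q.2 ^ (n - 1))).mul (hFm.comp (by fun_prop))
    exact hm.lintegral_prod_right'

theorem sq_lintegral_le {α : Type*} [MeasurableSpace α] (μ : Measure α) {f : α → ℝ≥0∞}
    (hf : AEMeasurable f μ) : (∫⁻ x, f x ∂μ) ^ 2 ≤ μ univ * ∫⁻ x, f x ^ 2 ∂μ := by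
  have h := ENNReal.lintegral_mul_le_Lp_mul_Lq μ Real.HolderConjugate.two_two
    (f := fun _ => 1) aemeasurable_const hf
  have h2 : ∀ a : ℝ≥0∞, (a ^ (1 / 2 : ℝ)) ^ 2 = a := fun a => by
    rw [← ENNReal.rpow_natCast, ← ENNReal.rpow_mul]; norm_num
  calc (∫⁻ x, f x ∂μ) ^ 2 ≤ ((∫⁻ _, (1 : ℝ≥0∞) ^ (2 : ℝ) ∂μ) ^ (1 / 2 : ℝ)
        * (∫⁻ x, f x ^ (2 : ℝ) ∂μ) ^ (1 / 2 : ℝ)) ^ 2 := by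
        gcongr
        simpa using h
    _ = _ := by
        rw [mul_pow, h2, h2]
        simp

/-- If a measurable relation holds between almost every `b` and each of its fixed proper multiples
`c * b`, then it holds, in both orders, between almost all pairs. -/
theorem ae_ae_ae_of_forall_dilation {X : Type*} [MeasurableSpace X] {μ : Measure X} [SFinite μ]
    {P : X → ℝ → ℝ → Prop} (hP : MeasurableSet {p : X × ℝ × ℝ | P p.1 p.2.1 p.2.2})
    (h : ∀ c ∈ Ioo (0 : ℝ) 1, ∀ᵐ x ∂μ, ∀ᵐ b, 0 < b → P x (c * b) b) :
    ∀ᵐ b, ∀ᵐ x ∂μ, ∀ᵐ a, (0 < a → a < b → P x a b) ∧ (0 < b → b < a → P x b a) := by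
  set Q : X → ℝ → ℝ → Prop := fun x a b => 0 < a → a < b → P x a b with hQ
  have hQm : MeasurableSet {p : X × ℝ × ℝ | Q p.1 p.2.1 p.2.2} :=
    (measurableSet_lt measurable_const (by fun_prop)).imp
      ((measurableSet_lt (by fun_prop) (by fun_prop)).imp hP)
  have h1 : ∀ᵐ c : ℝ, ∀ᵐ q : X × ℝ ∂(μ.prod volume), c ∈ Ioo (0 : ℝ) 1 → 0 < q.2 →
      P q.1 (c * q.2) q.2 := by
    refine Eventually.of_forall fun c => ?_
    by_cases hc : c ∈ Ioo (0 : ℝ) 1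
    · have hm : MeasurableSet {q : X × ℝ | 0 < q.2 → P q.1 (c * q.2) q.2} :=
        (measurableSet_lt measurable_const (by fun_prop)).imp
          (hP.preimage (by fun_prop : Measurable fun q : X × ℝ => (q.1, c * q.2, q.2)))
      have := (Measure.ae_prod_mem_iff_ae_ae_mem hm).2 (h c hc)
      filter_upwards [this] with q hq _ using hq
    · exact Eventually.of_forall fun q hc' => absurd hc' hc
  rw [Measure.ae_ae_comm] at h1
  swap
  · refine MeasurableSet.imp ?_ (MeasurableSet.imp ?_ ?_)
    · exact measurableSet_Ioo.preimage measurable_fst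
    · exact measurableSet_lt measurable_const (by fun_prop)
    · exact hP.preimage
        (by fun_prop : Measurable fun q : ℝ × X × ℝ => (q.2.1, q.1 * q.2.2, q.2.2))
  have h2 : ∀ᵐ x ∂μ, ∀ᵐ b, ∀ᵐ a, Q x a b := by
    refine Measure.ae_ae_of_ae_prod (p := fun q : X × ℝ => ∀ᵐ a, Q q.1 a q.2) ?_
    filter_upwards [h1] with q hq
    rcases le_or_gt q.2 0 with hb | hb
    · exact Eventually.of_forall fun a ha hab => absurd (ha.trans hab) (not_lt.2 hb)
    · have hqm := Measure.quasiMeasurePreserving_smul (volume : Measure ℝ) (inv_ne_zero hb.ne')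
      filter_upwards [hqm.ae hq] with a ha ha0 hab
      rw [smul_eq_mul] at ha
      have := ha ⟨by positivity, by rwa [inv_mul_lt_one₀ hb]⟩ hb
      rwa [mul_comm, mul_inv_cancel_left₀ hb.ne'] at this
  have h3 : ∀ᵐ x ∂μ, ∀ᵐ b, ∀ᵐ a, Q x a b ∧ Q x b a := by
    filter_upwards [h2] with x hx
    have h4 : ∀ᵐ a : ℝ, ∀ᵐ b : ℝ, Q x a b := by
      rwa [Measure.ae_ae_comm]
      exact hQm.preimage (by fun_prop : Measurable fun q : ℝ × ℝ => (x, q.1, q.2))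
    filter_upwards [hx, h4] with b hb1 hb2
    filter_upwards [hb1, hb2] with a ha1 ha2 using ⟨ha1, ha2⟩
  rwa [Measure.ae_ae_comm] at h3
  have hm : MeasurableSet {p : (X × ℝ) × ℝ | Q p.1.1 p.2 p.1.2 ∧ Q p.1.1 p.1.2 p.2} :=
    (hQm.preimage (by fun_prop : Measurable fun p : (X × ℝ) × ℝ => (p.1.1, p.2, p.1.2))).inter
      (hQm.preimage (by fun_prop : Measurable fun p : (X × ℝ) × ℝ => (p.1.1, p.1.2, p.2)))
  exact (measurable_measure_prodMk_left (ν := (volume : Measure ℝ)) hm.compl)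
    (measurableSet_singleton 0)

end Polar

/-! ### Sobolev maps along rays -/

section Radial

/-- If the oscillation `q` about the radius `ρ` is at most the integral of the speed `κ`, its
weighted square integral is controlled by the one of the speed. Near the origin the factor is the
length `r` of the interval, as the weight `t ^ d` is increasing; on `(r, 1)` only the scale
invariant weight `t` is used. -/
theorem lintegral_pow_mul_sq_le {q κ : ℝ → ℝ≥0∞} (hκ : Measurable κ) {r ρ : ℝ} (hr : 0 < r)
    (hρ : ρ ∈ Ioo r 1) (d : ℕ)
    (h : ∀ᵐ t, t ∈ Ioo (0 : ℝ) 1 → q t ≤ ∫⁻ τ in uIoc ρ t, κ τ) :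
    ∫⁻ t in Ioo (0 : ℝ) 1, ENNReal.ofReal (t ^ d) * q t ^ 2
      ≤ ENNReal.ofReal r * (∫⁻ t in Ioo (0 : ℝ) 1, ENNReal.ofReal (t ^ d) * κ t ^ 2)
        + ENNReal.ofReal r⁻¹ * ∫⁻ t in Ioo r 1, ENNReal.ofReal t * κ t ^ 2 := by
  have hr1 : r < 1 := hρ.1.trans hρ.2
  have hsq : ∀ t ∈ Ioo (0 : ℝ) 1, q t ≤ ∫⁻ τ in uIoc ρ t, κ τ →
      q t ^ 2 ≤ ∫⁻ τ in uIoc ρ t, κ τ ^ 2 := by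
    intro t ht hq
    have h1 : (volume.restrict (uIoc ρ t)) univ ≤ 1 := by
      rw [Measure.restrict_apply_univ, uIoc, Real.volume_Ioc, ← ENNReal.ofReal_one]
      refine ENNReal.ofReal_le_ofReal ?_
      have h2 : max ρ t < 1 := max_lt hρ.2 ht.2
      have h3 : 0 < min ρ t := lt_min (hr.trans hρ.1) ht.1
      linarith
    calc q t ^ 2 ≤ (∫⁻ τ in uIoc ρ t, κ τ) ^ 2 := by gcongr
      _ ≤ _ := sq_lintegral_le _ hκ.aemeasurable
      _ ≤ 1 * ∫⁻ τ in uIoc ρ t, κ τ ^ 2 := by gcongr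
      _ = _ := one_mul _
  have hm : Measurable fun τ => κ τ ^ 2 := hκ.pow_const 2
  have hin : ∫⁻ t in Ioc 0 r, ENNReal.ofReal (t ^ d) * q t ^ 2
      ≤ ENNReal.ofReal r * (∫⁻ t in Ioo (0 : ℝ) 1, ENNReal.ofReal (t ^ d) * κ t ^ 2) := by
    calc _ ≤ ∫⁻ _ in Ioc 0 r, ∫⁻ τ in Ioo (0 : ℝ) 1, ENNReal.ofReal (τ ^ d) * κ τ ^ 2 := by
          refine setLIntegral_mono_ae' measurableSet_Ioc ?_
          filter_upwards [h] with t ht htr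
          have ht01 : t ∈ Ioo (0 : ℝ) 1 := ⟨htr.1, htr.2.trans_lt hr1⟩
          have htρ : t ≤ ρ := htr.2.trans hρ.1.le
          calc _ ≤ ENNReal.ofReal (t ^ d) * ∫⁻ τ in Ioc t ρ, κ τ ^ 2 := by
                gcongr
                rw [← uIoc_of_ge htρ]
                exact hsq t ht01 (ht ht01)
            _ = ∫⁻ τ in Ioc t ρ, ENNReal.ofReal (t ^ d) * κ τ ^ 2 :=
                (lintegral_const_mul _ hm).symm
            _ ≤ ∫⁻ τ in Ioc t ρ, ENNReal.ofReal (τ ^ d) * κ τ ^ 2 := by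
                refine setLIntegral_mono' measurableSet_Ioc fun τ hτ => ?_
                have h1 := hτ.1.le
                have h2 := htr.1.le
                gcongr
            _ ≤ _ := by
                refine lintegral_mono_set fun τ hτ => ?_
                exact ⟨htr.1.trans hτ.1, hτ.2.trans_lt hρ.2⟩
      _ = _ := by simp [mul_comm]
  have hout : ∫⁻ t in Ioo r 1, ENNReal.ofReal (t ^ d) * q t ^ 2
      ≤ ENNReal.ofReal r⁻¹ * ∫⁻ t in Ioo r 1, ENNReal.ofReal t * κ t ^ 2 := by
    calc _ ≤ ∫⁻ _ in Ioo r 1,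
          (ENNReal.ofReal r⁻¹ * ∫⁻ τ in Ioo r 1, ENNReal.ofReal τ * κ τ ^ 2) := by
          refine setLIntegral_mono_ae' measurableSet_Ioo ?_
          filter_upwards [h] with t ht htr
          have ht01 : t ∈ Ioo (0 : ℝ) 1 := ⟨hr.trans htr.1, htr.2⟩
          calc _ ≤ 1 * q t ^ 2 := by
                gcongr
                exact ENNReal.ofReal_le_one.2 (pow_le_one₀ ht01.1.le ht01.2.le)
            _ ≤ ∫⁻ τ in uIoc ρ t, κ τ ^ 2 := by
                rw [one_mul]; exact hsq t ht01 (ht ht01)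
            _ ≤ ∫⁻ τ in Ioo r 1, κ τ ^ 2 := by
                refine lintegral_mono_set fun τ hτ => ?_
                exact ⟨(lt_min hρ.1 htr.1).trans hτ.1, hτ.2.trans_lt (max_lt hρ.2 htr.2)⟩
            _ ≤ ∫⁻ τ in Ioo r 1, ENNReal.ofReal r⁻¹ * (ENNReal.ofReal τ * κ τ ^ 2) := by
                refine setLIntegral_mono' measurableSet_Ioo fun τ hτ => ?_
                rw [← mul_assoc, ← ENNReal.ofReal_mul (by positivity)]
                refine le_mul_of_one_le_left (by positivity) (ENNReal.one_le_ofReal.2 ?_)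
                rw [inv_mul_eq_div, one_le_div hr]
                exact hτ.1.le
            _ = _ := lintegral_const_mul _ (by fun_prop)
      _ = ENNReal.ofReal (1 - r)
          * (ENNReal.ofReal r⁻¹ * ∫⁻ t in Ioo r 1, ENNReal.ofReal t * κ t ^ 2) := by
          simp [mul_comm]
      _ ≤ 1 * (ENNReal.ofReal r⁻¹ * ∫⁻ t in Ioo r 1, ENNReal.ofReal t * κ t ^ 2) := by
          gcongr
          exact ENNReal.ofReal_le_one.2 (by linarith)
      _ = _ := one_mul _
  rw [← Ioc_union_Ioo_eq_Ioo hr.le hr1]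
  refine (lintegral_union_le _ _ _).trans ?_
  rw [Ioc_union_Ioo_eq_Ioo hr.le hr1]
  exact add_le_add hin hout

variable {n K : ℕ} {u R : Euc n → Euc K}

theorem measurable_intervalIntegral_ray (hR : StronglyMeasurable R) :
    Measurable fun p : sphere (0 : Euc n) 1 × ℝ × ℝ =>
      ∫ τ in p.2.1..p.2.2, τ⁻¹ • R (τ • (p.1 : Euc n)) := by
  have key : ∀ g h : sphere (0 : Euc n) 1 × ℝ × ℝ → ℝ, Measurable g → Measurable h →
      StronglyMeasurable fun p : sphere (0 : Euc n) 1 × ℝ × ℝ =>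
        ∫ τ in Ioc (g p) (h p), τ⁻¹ • R (τ • (p.1 : Euc n)) := by
    intro g h hg hh
    have h1 : StronglyMeasurable fun q : (sphere (0 : Euc n) 1 × ℝ × ℝ) × ℝ =>
        {q : (sphere (0 : Euc n) 1 × ℝ × ℝ) × ℝ | q.2 ∈ Ioc (g q.1) (h q.1)}.indicator
          (fun q => q.2⁻¹ • R (q.2 • (q.1.1 : Euc n))) q := by
      refine StronglyMeasurable.indicator ?_ ?_
      · exact (measurable_snd.inv.stronglyMeasurable).smul (hR.comp_measurable (by fun_prop))
      · exact (measurableSet_lt (hg.comp measurable_fst) measurable_snd).inter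
          (measurableSet_le measurable_snd (hh.comp measurable_fst))
    have h2 : (fun p : sphere (0 : Euc n) 1 × ℝ × ℝ =>
        ∫ τ in Ioc (g p) (h p), τ⁻¹ • R (τ • (p.1 : Euc n))) = fun p => ∫ τ : ℝ,
          {q : (sphere (0 : Euc n) 1 × ℝ × ℝ) × ℝ | q.2 ∈ Ioc (g q.1) (h q.1)}.indicator
            (fun q => q.2⁻¹ • R (q.2 • (q.1.1 : Euc n))) (p, τ) := by
      funext p
      rw [← integral_indicator measurableSet_Ioc]
      rfl
    rw [h2]
    exact h1.integral_prod_right' (ν := volume)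
  simp only [intervalIntegral]
  exact ((key _ _ (by fun_prop) (by fun_prop)).sub (key _ _ (by fun_prop) (by fun_prop))).measurable

/-- For almost every radius `b`, on almost every ray, the values of a Sobolev map differ from the
value at `b` by the integral of the radial derivative. -/
theorem IsWeakEulerDeriv.ae_sub_eq_integral_ray (h : IsWeakEulerDeriv (ball 0 2) u R)
    (hn : n ≠ 0) (hu : Integrable u) (hum : StronglyMeasurable u)
    (hu0 : ∀ x ∉ ball (0 : Euc n) 2, u x = 0) (hR : Integrable R) (hRm : StronglyMeasurable R) :
    ∀ᵐ b : ℝ, b ∈ Ioo (0 : ℝ) 1 → ∀ᵐ w : sphere (0 : Euc n) 1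
      ∂(volume : Measure (Euc n)).toSphere, ∀ᵐ a : ℝ, a ∈ Ioo (0 : ℝ) 1 →
        u (a • (w : Euc n)) - u (b • (w : Euc n)) = ∫ τ in b..a, τ⁻¹ • R (τ • (w : Euc n)) := by
  have key := ae_ae_ae_of_forall_dilation (μ := (volume : Measure (Euc n)).toSphere)
    (P := fun w a b => b < 1 →
      u (b • (w : Euc n)) - u (a • (w : Euc n)) = ∫ τ in a..b, τ⁻¹ • R (τ • (w : Euc n))) (by
      refine (measurableSet_lt (by fun_prop) measurable_const).imp ?_
      exact measurableSet_eq_fun ((hum.measurable.comp (by fun_prop)).sub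
        (hum.measurable.comp (by fun_prop))) (measurable_intervalIntegral_ray hRm)) (by
      intro c hc
      filter_upwards [ae_sphere_of_ae hn (h.ae_sub_eq_integral hn hu hu0 hR hRm hc.1 hc.2.le)]
        with w hw
      filter_upwards [hw] with b hb hb0 hb1
      have h1 := hb hb0 (by simp [norm_smul, abs_of_pos hb0, hb1])
      rw [smul_smul] at h1
      rw [h1]
      have h2 := intervalIntegral.integral_comp_mul_right (a := c) (b := 1)
        (fun τ : ℝ => τ⁻¹ • R (τ • (w : Euc n))) hb0.ne'
      rw [one_mul, eq_comm, inv_smul_eq_iff₀ hb0.ne'] at h2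
      rw [h2, ← intervalIntegral.integral_smul]
      refine intervalIntegral.integral_congr fun σ _ => ?_
      simp only [smul_smul]
      congr 1
      field_simp)
  filter_upwards [key] with b hb hb01
  filter_upwards [hb] with w hw
  filter_upwards [hw, Measure.ae_ne volume b] with a ha hab ha01
  rcases lt_or_gt_of_ne hab with hlt | hgt
  · rw [intervalIntegral.integral_symm, ← ha.1 ha01.1 hlt hb01.2]
    abel
  · exact ha.2 hb01.1 hgt ha01.2

/-- The radial derivative is integrable on almost every ray, away from the origin. -/
theorem ae_intervalIntegrable_ray (hn : n ≠ 0) (hR : Integrable R) (hRm : StronglyMeasurable R) :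
    ∀ᵐ w : sphere (0 : Euc n) 1 ∂(volume : Measure (Euc n)).toSphere,
      ∀ s ∈ Ioo (0 : ℝ) 1, ∀ t ∈ Ioo (0 : ℝ) 1,
        IntervalIntegrable (fun τ => τ⁻¹ • R (τ • (w : Euc n))) volume s t := by
  have hRe : Measurable fun x => ‖R x‖ₑ := hRm.enorm
  have hm : Measurable fun q : sphere (0 : Euc n) 1 × ℝ =>
      ENNReal.ofReal (q.2 ^ (n - 1)) * ‖R (q.2 • (q.1 : Euc n))‖ₑ :=
    (by fun_prop : Measurable fun q : sphere (0 : Euc n) 1 × ℝ =>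
      ENNReal.ofReal (q.2 ^ (n - 1))).mul (hRe.comp (by fun_prop))
  have h1 := lintegral_eq_lintegral_sphere hn hRe
  have h2 := ae_lt_top (hm.lintegral_prod_right' (ν := volume.restrict (Ioi (0 : ℝ))))
    (h1 ▸ hR.2.ne)
  filter_upwards [h2] with w hw
  have hon : ∀ s t : ℝ, 0 < s → IntegrableOn (fun τ => τ⁻¹ • R (τ • (w : Euc n))) (Ioc s t) := by
    intro s t hs
    refine ⟨((measurable_id.inv.stronglyMeasurable).smul
      (hRm.comp_measurable (by fun_prop))).aestronglyMeasurable, ?_⟩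
    calc ∫⁻ τ in Ioc s t, ‖τ⁻¹ • R (τ • (w : Euc n))‖ₑ
        ≤ ∫⁻ τ in Ioc s t, ENNReal.ofReal (s⁻¹ ^ n) *
            (ENNReal.ofReal (τ ^ (n - 1)) * ‖R (τ • (w : Euc n))‖ₑ) := by
          refine setLIntegral_mono' measurableSet_Ioc fun τ hτ => ?_
          have hτ0 : 0 < τ := hs.trans hτ.1
          rw [enorm_smul, ← mul_assoc, ← ENNReal.ofReal_mul (by positivity),
            Real.enorm_of_nonneg (by positivity)]
          gcongr
          obtain ⟨d, rfl⟩ := Nat.exists_eq_succ_of_ne_zero hn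
          simp only [Nat.succ_eq_add_one, Nat.add_sub_cancel]
          calc τ⁻¹
              = τ⁻¹ ^ (d + 1) * τ ^ d := by
                rw [pow_succ, mul_right_comm, ← mul_pow, inv_mul_cancel₀ hτ0.ne', one_pow, one_mul]
            _ ≤ s⁻¹ ^ (d + 1) * τ ^ d := by
              have := hτ.1.le
              gcongr
      _ = ENNReal.ofReal (s⁻¹ ^ n) * ∫⁻ τ in Ioc s t,
            (ENNReal.ofReal (τ ^ (n - 1)) * ‖R (τ • (w : Euc n))‖ₑ) :=
          lintegral_const_mul' _ _ ENNReal.ofReal_ne_top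
      _ ≤ ENNReal.ofReal (s⁻¹ ^ n) * ∫⁻ τ in Ioi 0,
            (ENNReal.ofReal (τ ^ (n - 1)) * ‖R (τ • (w : Euc n))‖ₑ) := by
          gcongr
          exact fun τ hτ => hs.trans hτ.1
      _ < ⊤ := ENNReal.mul_lt_top ENNReal.ofReal_lt_top hw
  exact fun s hs t ht => ⟨hon s t hs.1, hon t s ht.1⟩

end Radial

/-! ### The comparison with a homogeneous map -/

section Assembly

variable {n m K : ℕ}

theorem IsSobolev.congr_ae {s : Set (Euc n)} {u u' : Euc n → Euc K} {G G' : Euc n → Fin n → Euc K}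
    (h : IsSobolev s u G) (hu : u =ᵐ[volume.restrict s] u')
    (hG : ∀ i, (fun x => G x i) =ᵐ[volume.restrict s] fun x => G' x i) : IsSobolev s u' G' where
  memLp := h.memLp.ae_eq hu
  memLp_grad i := (h.memLp_grad i).ae_eq (hG i)
  weakGradient φ hφ hφc hφs i := by
    have h1 : ∫ x in s, (fderiv ℝ φ x (basisVec i)) • u' x
        = ∫ x in s, (fderiv ℝ φ x (basisVec i)) • u x := by
      refine integral_congr_ae ?_
      filter_upwards [hu] with x hx using by rw [hx]
    have h2 : ∫ x in s, φ x • G' x i = ∫ x in s, φ x • G x i := by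
      refine integral_congr_ae ?_
      filter_upwards [hG i] with x hx using by rw [hx]
    rw [h1, h2]
    exact h.weakGradient φ hφ hφc hφs i

theorem setLIntegral_eq_of_eq_indicator {A B : Set ℝ} (hA : MeasurableSet A) (hB : MeasurableSet B)
    (hAB : A ⊆ B) {g g' : ℝ → ℝ≥0∞} (h : ∀ t ∈ B, g t = A.indicator g' t) :
    ∫⁻ t in B, g t = ∫⁻ t in A, g' t := by
  rw [setLIntegral_congr_fun hB h, setLIntegral_indicator hA, inter_eq_self_of_subset_left hAB]

/-- The extension of the values of `f` on the sphere of radius `ρ` along rays. At the origin, where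
`‖z‖⁻¹ = 0`, it takes the value `f 0`. -/
theorem isHomogeneous_comp_radial {N : Type*} [MeasurableSpace N] {f : Euc n → N}
    (hf : Measurable f) (ρ : ℝ) : IsHomogeneous 0 fun z => f ((ρ * ‖z‖⁻¹) • z) := by
  refine ⟨hf.comp (by fun_prop), ⊥, finrank_bot ℝ _, fun c z hc => ?_, fun z v hv => ?_⟩
  · change f _ = f _
    rw [norm_smul, Real.norm_of_nonneg hc.le, smul_smul]
    congr 2
    field_simp
  · rw [(Submodule.mem_bot ℝ).1 hv, add_zero]

variable {N : Type*} [EMetricSpace N] [ChartedSpace (Euc m) N] [IsManifold (𝓡 m) ∞ N]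
  [Bundle.RiemannianBundle (fun p : N => TangentSpace (𝓡 m) p)] [IsRiemannianManifold (𝓡 m) N]
  [MeasurableSpace N] [BorelSpace N] {ι : N → Euc K}

/-- The values of a Sobolev map on a well chosen sphere of radius `ρ ∈ (r, 1)` extend to a
`0`-homogeneous map whose distance to the given map is controlled by the full energy with a
small factor `r`, and by the energy of the radial derivative on the annulus. -/
theorem exists_isHomogeneous_lintegral_edist_sq_le (hn : n ≠ 0) (hι : IsIsometricEmbedding m ι)
    {f : Euc n → N} (hf : Measurable f) {G : Euc n → Fin n → Euc K}
    (hG : ∀ i, StronglyMeasurable fun x => G x i) (hs : IsSobolev (ball 0 2) (ι ∘ f) G)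
    {r : ℝ} (hr : 0 < r) (hr1 : r < 1) :
    ∃ h : Euc n → N, IsHomogeneous 0 h ∧ ∫⁻ z in ball 0 1, edist (f z) (h z) ^ 2
      ≤ ENNReal.ofReal r * (∫⁻ x in ball (0 : Euc n) 1, ENNReal.ofReal (energyDensity G x))
        + ENNReal.ofReal r⁻¹ * ∫⁻ x in ball (0 : Euc n) 2,
          ENNReal.ofReal (annulusWeight n (r ^ 2) (‖x‖ ^ 2) * ‖eulerDeriv G x‖ ^ 2) := by
  have : SecondCountableTopology N := hι.isClosedEmbedding.isEmbedding.secondCountableTopology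
  have hvol : volume (ball (0 : Euc n) 2) ≠ ⊤ := measure_ball_lt_top.ne
  set u : Euc n → Euc K := (ball 0 2).indicator (ι ∘ f) with hu
  set R : Euc n → Euc K := (ball 0 2).indicator (eulerDeriv G) with hR
  have hE : StronglyMeasurable (eulerDeriv G) := by
    refine Finset.stronglyMeasurable_fun_sum _ fun i _ => ?_
    exact (by fun_prop : Continuous fun x : Euc n => x i).stronglyMeasurable.smul (hG i)
  have hum : StronglyMeasurable u :=
    ((hι.isClosedEmbedding.continuous.measurable.comp hf).stronglyMeasurable).indicator
      measurableSet_ball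
  have hRm : StronglyMeasurable R := hE.indicator measurableSet_ball
  have hui : Integrable u := (integrable_indicator_iff measurableSet_ball).2 (hs.integrableOn hvol)
  have hRi : Integrable R := by
    refine (integrable_indicator_iff measurableSet_ball).2 ?_
    refine integrable_finsetSum _ fun i _ => ?_
    refine (hs.integrableOn_grad hvol i).bdd_smul 2
      (by fun_prop : Continuous fun x : Euc n => x i).aestronglyMeasurable ?_
    filter_upwards [ae_restrict_mem measurableSet_ball] with x hx
    exact (PiLp.norm_apply_le x i).trans (mem_ball_zero_iff.1 hx).le
  have hweak := hs.isWeakEulerDeriv measurableSet_ball hvol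
  have hnorm : ∀ (w : sphere (0 : Euc n) 1) (t : ℝ), 0 < t → ‖t • (w : Euc n)‖ = t := by
    intro w t ht
    simp [norm_smul, abs_of_pos ht]
  have hin : ∀ (w : sphere (0 : Euc n) 1), ∀ t ∈ Ioo (0 : ℝ) 1, t • (w : Euc n) ∈ ball 0 2 := by
    intro w t ht
    rw [mem_ball_zero_iff, hnorm w t ht.1]
    linarith [ht.2]
  obtain ⟨ρ, hρ, hρray⟩ : ∃ ρ ∈ Ioo r 1, ∀ᵐ w : sphere (0 : Euc n) 1
      ∂(volume : Measure (Euc n)).toSphere, ∀ᵐ a : ℝ, a ∈ Ioo (0 : ℝ) 1 →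
        u (a • (w : Euc n)) - u (ρ • (w : Euc n)) = ∫ τ in ρ..a, τ⁻¹ • R (τ • (w : Euc n)) := by
    have h1 := hweak.ae_sub_eq_integral_ray hn hui hum
      (fun x hx => indicator_of_notMem hx _) hRi hRm
    have : NeBot (ae (volume.restrict (Ioo r 1))) := by
      rw [ae_neBot, Ne, Measure.restrict_eq_zero, Real.volume_Ioo]
      simpa using hr1
    obtain ⟨ρ, h2, h3⟩ :=
      ((ae_restrict_of_ae h1).and (ae_restrict_mem (measurableSet_Ioo (a := r) (b := 1)))).exists
    exact ⟨ρ, h3, h2 ⟨hr.trans h3.1, h3.2⟩⟩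
  have hρ01 : ρ ∈ Ioo (0 : ℝ) 1 := ⟨hr.trans hρ.1, hρ.2⟩
  refine ⟨_, isHomogeneous_comp_radial hf ρ, ?_⟩
  set h : Euc n → N := fun z => f ((ρ * ‖z‖⁻¹) • z) with hh
  have hhm : Measurable h := hf.comp (by fun_prop)
  have hhw : ∀ (w : sphere (0 : Euc n) 1) (t : ℝ), 0 < t →
      h (t • (w : Euc n)) = f (ρ • (w : Euc n)) := by
    intro w t ht
    simp only [hh, hnorm w t ht, smul_smul]
    rw [inv_mul_cancel_right₀ ht.ne']
  -- the densities whose polar integrals are the two terms on the right-hand side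
  set FA : Euc n → ℝ≥0∞ := (ball 0 1).indicator fun x => ‖‖x‖⁻¹ • R x‖ₑ ^ 2 with hFA
  set FB : Euc n → ℝ≥0∞ := fun x =>
    ENNReal.ofReal (annulusWeight n (r ^ 2) (‖x‖ ^ 2)) * ‖R x‖ₑ ^ 2 with hFB
  have hFAm : Measurable FA := by
    refine Measurable.indicator ?_ measurableSet_ball
    exact (((by fun_prop : Measurable fun x : Euc n => ‖x‖⁻¹).stronglyMeasurable.smul
      hRm).enorm).pow_const 2
  have hFBm : Measurable FB :=
    ((measurable_annulusWeight n _).comp (by fun_prop)).ennreal_ofReal.mul (hRm.enorm.pow_const 2)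
  have hFm : Measurable ((ball (0 : Euc n) 1).indicator fun z => edist (f z) (h z) ^ 2) :=
    ((hf.edist hhm).pow_const 2).indicator measurableSet_ball
  have hinner : ∀ {F : Euc n → ℝ≥0∞}, Measurable F →
      Measurable fun w : sphere (0 : Euc n) 1 => ∫⁻ t in Ioi (0 : ℝ),
        ENNReal.ofReal (t ^ (n - 1)) * F (t • (w : Euc n)) := by
    intro F hF
    have hm : Measurable fun q : sphere (0 : Euc n) 1 × ℝ =>
        ENNReal.ofReal (q.2 ^ (n - 1)) * F (q.2 • (q.1 : Euc n)) :=
      (by fun_prop : Measurable fun q : sphere (0 : Euc n) 1 × ℝ =>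
        ENNReal.ofReal (q.2 ^ (n - 1))).mul (hF.comp (by fun_prop))
    exact hm.lintegral_prod_right'
  have hray : ∀ᵐ w : sphere (0 : Euc n) 1 ∂(volume : Measure (Euc n)).toSphere,
      ∫⁻ t in Ioi (0 : ℝ), ENNReal.ofReal (t ^ (n - 1)) *
          (ball (0 : Euc n) 1).indicator (fun z => edist (f z) (h z) ^ 2) (t • (w : Euc n))
        ≤ ENNReal.ofReal r * (∫⁻ t in Ioi (0 : ℝ), ENNReal.ofReal (t ^ (n - 1))
            * FA (t • (w : Euc n)))
          + ENNReal.ofReal r⁻¹ * ∫⁻ t in Ioi (0 : ℝ), ENNReal.ofReal (t ^ (n - 1))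
            * FB (t • (w : Euc n)) := by
    filter_upwards [hρray, ae_intervalIntegrable_ray hn hRi hRm] with w hw hwi
    have h1 := ae_edist_le_lintegral_of_ae_sub_eq hι (w := fun t => f (t • (w : Euc n)))
      (g := fun τ => τ⁻¹ • R (τ • (w : Euc n))) hρ01 hwi (by
        filter_upwards [hw] with a ha ha01
        rw [← ha ha01, hu, indicator_of_mem (hin w a ha01), indicator_of_mem (hin w ρ hρ01)]
        rfl)
    have h2 := lintegral_pow_mul_sq_le (q := fun t => edist (f (t • (w : Euc n)))
      (f (ρ • (w : Euc n)))) (κ := fun τ => ‖τ⁻¹ • R (τ • (w : Euc n))‖ₑ)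
      (((measurable_id.inv.stronglyMeasurable).smul (hRm.comp_measurable (by fun_prop))).enorm)
      hr hρ (n - 1) h1
    have hball : ∀ t : ℝ, 0 < t → (t • (w : Euc n) ∈ ball (0 : Euc n) 1 ↔ t ∈ Ioo (0 : ℝ) 1) := by
      intro t ht
      rw [mem_ball_zero_iff, hnorm w t ht]
      exact ⟨fun h => ⟨ht, h⟩, fun h => h.2⟩
    have hsub : Ioo (0 : ℝ) 1 ⊆ Ioi 0 := fun t ht => ht.1
    have e1 : ∫⁻ t in Ioi (0 : ℝ), ENNReal.ofReal (t ^ (n - 1)) *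
          (ball (0 : Euc n) 1).indicator (fun z => edist (f z) (h z) ^ 2) (t • (w : Euc n))
        = ∫⁻ t in Ioo (0 : ℝ) 1, ENNReal.ofReal (t ^ (n - 1)) *
          edist (f (t • (w : Euc n))) (f (ρ • (w : Euc n))) ^ 2 := by
      refine setLIntegral_eq_of_eq_indicator measurableSet_Ioo measurableSet_Ioi hsub fun t ht => ?_
      by_cases ht1 : t ∈ Ioo (0 : ℝ) 1
      · rw [indicator_of_mem ht1, indicator_of_mem ((hball t ht).2 ht1), hhw w t ht]
      · rw [indicator_of_notMem ht1, indicator_of_notMem (fun h => ht1 ((hball t ht).1 h)),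
          mul_zero]
    have e2 : ∫⁻ t in Ioi (0 : ℝ), ENNReal.ofReal (t ^ (n - 1)) * FA (t • (w : Euc n))
        = ∫⁻ t in Ioo (0 : ℝ) 1, ENNReal.ofReal (t ^ (n - 1)) *
          ‖t⁻¹ • R (t • (w : Euc n))‖ₑ ^ 2 := by
      refine setLIntegral_eq_of_eq_indicator measurableSet_Ioo measurableSet_Ioi hsub fun t ht => ?_
      by_cases ht1 : t ∈ Ioo (0 : ℝ) 1
      · rw [indicator_of_mem ht1, hFA, indicator_of_mem ((hball t ht).2 ht1), hnorm w t ht]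
      · rw [indicator_of_notMem ht1, hFA, indicator_of_notMem (fun h => ht1 ((hball t ht).1 h)),
          mul_zero]
    have e3 : ∫⁻ t in Ioi (0 : ℝ), ENNReal.ofReal (t ^ (n - 1)) * FB (t • (w : Euc n))
        = ∫⁻ t in Ioo r 1, ENNReal.ofReal t * ‖t⁻¹ • R (t • (w : Euc n))‖ₑ ^ 2 := by
      refine setLIntegral_eq_of_eq_indicator measurableSet_Ioo measurableSet_Ioi
        (fun t ht => hr.trans ht.1) fun t ht => ?_
      have ht0 : 0 < t := ht
      simp only [hFB]
      rw [hnorm w t ht]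
      by_cases ht1 : t ∈ Ioo r 1
      · have ht2 : t ^ 2 ∈ Ioo (r ^ 2) 1 :=
          ⟨pow_lt_pow_left₀ ht1.1 hr.le two_ne_zero, pow_lt_one₀ ht0.le ht1.2 two_ne_zero⟩
        have hpow : (t ^ 2) ^ (-(n : ℝ) / 2) = (t ^ n)⁻¹ := by
          rw [← Real.rpow_natCast t 2, ← Real.rpow_mul ht0.le, ← Real.rpow_natCast t n,
            ← Real.rpow_neg ht0.le]
          congr 1; push_cast; ring
        rw [indicator_of_mem ht1, annulusWeight, indicator_of_mem ht2, hpow, enorm_smul,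
          Real.enorm_of_nonneg (by positivity), mul_pow, ← ENNReal.ofReal_pow (by positivity),
          ← mul_assoc, ← mul_assoc, ← ENNReal.ofReal_mul (by positivity),
          ← ENNReal.ofReal_mul (by positivity)]
        congr 2
        obtain ⟨d, rfl⟩ := Nat.exists_eq_succ_of_ne_zero hn
        simp only [Nat.succ_eq_add_one, Nat.add_sub_cancel]
        field_simp
        ring
      · have ht2 : t ^ 2 ∉ Ioo (r ^ 2) 1 := fun h' => ht1
          ⟨lt_of_pow_lt_pow_left₀ 2 ht0.le h'.1, (sq_lt_one_iff₀ ht0.le).1 h'.2⟩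
        rw [indicator_of_notMem ht1, annulusWeight, indicator_of_notMem ht2]
        simp
    rw [e1, e2, e3]
    exact h2
  have hfin : ∫⁻ z in ball 0 1, edist (f z) (h z) ^ 2
      ≤ ENNReal.ofReal r * (∫⁻ x, FA x) + ENNReal.ofReal r⁻¹ * ∫⁻ x, FB x := by
    rw [← lintegral_indicator measurableSet_ball, lintegral_eq_lintegral_sphere hn hFm,
      lintegral_eq_lintegral_sphere hn hFAm, lintegral_eq_lintegral_sphere hn hFBm,
      ← lintegral_const_mul _ (hinner hFAm), ← lintegral_const_mul _ (hinner hFBm),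
      ← lintegral_add_left ((hinner hFAm).const_mul _)]
    exact lintegral_mono_ae hray
  refine hfin.trans (add_le_add (mul_le_mul' le_rfl ?_) (mul_le_mul' le_rfl ?_))
  · rw [hFA, lintegral_indicator measurableSet_ball]
    refine lintegral_mono fun x => ?_
    rw [← ofReal_norm, ← ENNReal.ofReal_pow (norm_nonneg _)]
    refine ENNReal.ofReal_le_ofReal ?_
    have h1 : ‖R x‖ ^ 2 ≤ ‖x‖ ^ 2 * energyDensity G x := by
      by_cases hx : x ∈ ball (0 : Euc n) 2
      · rw [hR, indicator_of_mem hx]; exact norm_eulerDeriv_sq_le G x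
      · rw [hR, indicator_of_notMem hx]
        have := energyDensity_nonneg G x
        rw [norm_zero, zero_pow two_ne_zero]; exact mul_nonneg (sq_nonneg _) this
    have h2 := energyDensity_nonneg G x
    rw [norm_smul, norm_inv, norm_norm, mul_pow, inv_pow]
    by_cases hx0 : ‖x‖ ^ 2 = 0
    · rw [hx0, inv_zero, zero_mul]; exact h2
    · rw [inv_mul_le_iff₀ (lt_of_le_of_ne (sq_nonneg _) (Ne.symm hx0))]
      exact h1
  · refine le_of_eq ?_
    rw [← lintegral_indicator measurableSet_ball]
    refine lintegral_congr fun x => ?_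
    simp only [hFB, hR]
    by_cases hx : x ∈ ball (0 : Euc n) 2
    · rw [indicator_of_mem hx, indicator_of_mem hx,
        ENNReal.ofReal_mul (annulusWeight_nonneg (by positivity) _), ← ofReal_norm,
        ENNReal.ofReal_pow (norm_nonneg _)]
    · rw [indicator_of_notMem hx, indicator_of_notMem hx]
      simp

end Assembly

end HarmonicMap

theorem theorem3p1 (n m : ℕ) {N : Type*} [EMetricSpace N] [ChartedSpace (HarmonicMap.Euc m) N]
    [IsManifold (𝓡 m) ∞ N]
    [Bundle.RiemannianBundle (fun p : N => TangentSpace (𝓡 m) p)]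
    [IsContMDiffRiemannianBundle (𝓡 m) ∞ (HarmonicMap.Euc m)
      (fun p : N => TangentSpace (𝓡 m) p)]
    [IsRiemannianManifold (𝓡 m) N] [MeasurableSpace N] [BorelSpace N]
    (Λ η : ℝ) (hη : 0 < η) :
    ∃ ε r : ℝ, 0 < ε ∧ 0 < r ∧ r < 1 ∧
      ∀ (K : ℕ) (ι : N → HarmonicMap.Euc K), HarmonicMap.IsIsometricEmbedding m ι →
      ∀ (f : HarmonicMap.Euc n → N)
        (Df : HarmonicMap.Euc n → Fin n → HarmonicMap.Euc K),
        HarmonicMap.IsStationaryHarmonic m ι (Metric.ball 0 2) f Df →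
        HarmonicMap.energy Df 0 2 < Λ →
        HarmonicMap.theta Df 0 1 - HarmonicMap.theta Df 0 r ≤ ε →
        HarmonicMap.IsAlmostHomogeneous η 1 0 0 f := by
  open HarmonicMap Metric Filter in
  -- a map on a point is homogeneous
  rcases eq_or_ne n 0 with rfl | hn
  · refine ⟨1, 1 / 2, one_pos, by norm_num, by norm_num, fun K ι _ f Df _ _ _ => ⟨f, ?_, ?_⟩⟩
    · refine ⟨Subsingleton.measurable, ⊥, finrank_bot ℝ _, fun c z _ => ?_, fun z v _ => ?_⟩ <;>
      exact congrArg f (Subsingleton.elim _ _)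
    · have h0 : ∀ z : Euc 0, edist (f (0 + (1 : ℝ) • z)) (f z) ^ 2 = 0 := fun z => by
        rw [Subsingleton.elim (0 + (1 : ℝ) • z) z]; simp
      simp only [h0]
      simpa using hη
  set V : ℝ := (volume (ball (0 : Euc n) 1)).toReal with hV
  have hV0 : 0 < V := ENNReal.toReal_pos (measure_ball_pos _ _ one_pos).ne' measure_ball_lt_top.ne
  -- `r` makes the energy term at most `η V / 4`, and `ε` makes the radial term at most `η V / 4`
  set r : ℝ := min (1 / 2) (η * V / (4 * (|Λ| + 1))) with hr
  have hr0 : 0 < r := by positivity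
  have hr1 : r < 1 := (min_le_left _ _).trans_lt (by norm_num)
  refine ⟨r * (η * V) / 2, r, by positivity, hr0, hr1, fun K ι hι f Df hst hΛ hθ => ?_⟩
  have hfm : AEMeasurable f (volume.restrict (ball (0 : Euc n) 2)) :=
    hι.isClosedEmbedding.measurableEmbedding.aemeasurable_comp_iff.1
      hst.isSobolev.memLp.1.aemeasurable
  have hGm := fun i => (hst.isSobolev.memLp_grad i).1
  -- only the class of `f` modulo null sets is known to be measurable, whereas the homogeneous map
  -- has to be measurable: Borel representatives are used from here on
  set f' : Euc n → N := hfm.mk f with hf'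
  set G : Euc n → Fin n → Euc K := fun x i => (hGm i).mk _ x with hG
  have hGae : ∀ i, (fun x => Df x i) =ᵐ[volume.restrict (ball 0 2)] fun x => G x i :=
    fun i => (hGm i).ae_eq_mk
  have hGall : ∀ᵐ x ∂volume.restrict (ball (0 : Euc n) 2), Df x = G x := by
    filter_upwards [ae_all_iff.2 hGae] with x hx using funext hx
  have hs : IsSobolev (ball 0 2) (ι ∘ f') G := by
    refine hst.isSobolev.congr_ae ?_ hGae
    filter_upwards [hfm.ae_eq_mk] with x hx using congrArg ι hx
  obtain ⟨h, hh, hle⟩ := exists_isHomogeneous_lintegral_edist_sq_le hn hι hfm.measurable_mk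
    (fun i => (hGm i).stronglyMeasurable_mk) hs hr0 hr1
  have h12 : ball (0 : Euc n) 1 ⊆ ball 0 2 := ball_subset_ball (by norm_num)
  have he := integrableOn_energyDensity hst.isSobolev.memLp_grad
  have hA : ∫⁻ x in ball (0 : Euc n) 1, ENNReal.ofReal (energyDensity G x) ≤ ENNReal.ofReal |Λ| := by
    calc _ ≤ ∫⁻ x in ball (0 : Euc n) 2, ENNReal.ofReal (energyDensity G x) :=
          lintegral_mono_set h12
      _ = ∫⁻ x in ball (0 : Euc n) 2, ENNReal.ofReal (energyDensity Df x) := by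
          refine lintegral_congr_ae ?_
          filter_upwards [hGall] with x hx
          simp only [energyDensity, hx]
      _ = ENNReal.ofReal (energy Df 0 2) :=
          (ofReal_integral_eq_lintegral_ofReal he
            (Eventually.of_forall fun x => energyDensity_nonneg Df x)).symm
      _ ≤ _ := ENNReal.ofReal_le_ofReal (hΛ.le.trans (le_abs_self Λ))
  have hB : ∫⁻ x in ball (0 : Euc n) 2,
      ENNReal.ofReal (annulusWeight n (r ^ 2) (‖x‖ ^ 2) * ‖eulerDeriv G x‖ ^ 2)
      ≤ ENNReal.ofReal (r * (η * V) / 4) := by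
    have hr2 : 0 < r ^ 2 := by positivity
    calc _ = ∫⁻ x in ball (0 : Euc n) 2,
          ENNReal.ofReal (annulusWeight n (r ^ 2) (‖x‖ ^ 2) * ‖eulerDeriv Df x‖ ^ 2) := by
          refine lintegral_congr_ae ?_
          filter_upwards [hGall] with x hx
          simp only [eulerDeriv, hx]
      _ = ENNReal.ofReal ((theta Df 0 1 - theta Df 0 r) / 2) := by
          rw [hst.isDomainStationary.theta_sub_theta hst.isSobolev.memLp_grad hr0 hr1,
            mul_div_cancel_left₀ _ two_ne_zero]
          exact (ofReal_integral_eq_lintegral_ofReal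
            (integrableOn_annulusWeight_mul hr2 hst.isSobolev.memLp_grad)
            (Eventually.of_forall fun x =>
              mul_nonneg (annulusWeight_nonneg hr2 _) (sq_nonneg _))).symm
      _ ≤ _ := ENNReal.ofReal_le_ofReal (by linarith)
  refine ⟨h, hh, ?_⟩
  rw [setLAverage_eq, ENNReal.div_lt_iff (Or.inl (measure_ball_pos _ _ one_pos).ne')
    (Or.inl measure_ball_lt_top.ne)]
  calc ∫⁻ z in ball (0 : Euc n) 1, edist (f (0 + (1 : ℝ) • z)) (h z) ^ 2
      = ∫⁻ z in ball (0 : Euc n) 1, edist (f' z) (h z) ^ 2 := by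
        refine lintegral_congr_ae ?_
        filter_upwards [ae_restrict_of_ae_restrict_of_subset h12 hfm.ae_eq_mk] with z hz
        rw [zero_add, one_smul, hz]
    _ ≤ _ := hle
    _ ≤ ENNReal.ofReal r * ENNReal.ofReal |Λ|
        + ENNReal.ofReal r⁻¹ * ENNReal.ofReal (r * (η * V) / 4) := by gcongr
    _ = ENNReal.ofReal (r * |Λ| + r⁻¹ * (r * (η * V) / 4)) := by
        rw [← ENNReal.ofReal_mul hr0.le, ← ENNReal.ofReal_mul (by positivity),
          ← ENNReal.ofReal_add (by positivity) (by positivity)]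
    _ < ENNReal.ofReal (η * V) := by
        refine (ENNReal.ofReal_lt_ofReal_iff (by positivity)).2 ?_
        have h1 : r⁻¹ * (r * (η * V) / 4) = η * V / 4 := by field_simp
        have h2 : r * |Λ| ≤ η * V / 4 := by
          calc r * |Λ| ≤ η * V / (4 * (|Λ| + 1)) * (|Λ| + 1) := by
                gcongr
                · exact min_le_right _ _
                · linarith
            _ = _ := by field_simp
        have h3 : 0 < η * V := by positivity
        rw [h1]; linarith
    _ = _ := by
        rw [ENNReal.ofReal_mul hη.le, hV, ENNReal.ofReal_toReal measure_ball_lt_top.ne]
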